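/- Let $\mathcal Q$ be the $\mathbb Q$-algebra of quasisymmetric functions in $x_1,x_2,\dots$. For $n\ge 0$ and $S=\{i_1<\dots<i_k\}\subseteq[n]=\{1,\dots,n\}$ let $M_S^{(n+1)}=\sum_{j_1<\dots<j_{k+1}}x_{j_1}^{\beta_1}\cdots x_{j_{k+1}}^{\beta_{k+1}}$ with $\beta=(i_1,i_2-i_1,\dots,i_k-i_{k-1},n+1-i_k)$ (and $\beta=(n+1)$ if $S=\emptyset$). Put $F_S^{(n+1)}=\sum_{S\subseteq T\subseteq[n]}M_T^{(n+1)}$ and $$\Theta_S^{(n+1)}=\sum_{T\subseteq[n],\ S\subseteq T\cup(T+1)}2^{|T|+1}M_T^{(n+1)}.$$ Together with $1$, the $M_S^{(n+1)}$ form a basis of $\mathcal Q$, and so do the $F_S^{(n+1)}$. Let $\Pi\subseteq\mathcal Q$ be the unital subalgebra generated by all $\Theta_S^{(n+1)}$ with $n\ge0$ and $S\subseteq[n]$ left sparse (that is, $1\notin S$, and $i\in S$ implies $i-1\notin S$), and let $\Pi_d$ be the space of elements of $\Pi$ that are homogeneous of degree $d$. Let $\vartheta:\mathcal Q\to\Pi$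 be the linear map with $\vartheta(1)=1$ and $\vartheta(F_S^{(n+1)})=\Theta_{\Lambda(S)}^{(n+1)}$ for $S\subseteq[n]$, $n\ge0$, where $\Lambda(S)=\{i\in S: i\ne1,\ i-1\notin S\}$. Let $L:\mathcal Q\to\mathcal Q$ be the linear map with $L(M_S^{(n+1)})=M_S^{(n+2)}$ for $S\subseteq[n]$, $n\ge0$, and $L(1)=0$. Put $\Theta_{\mathbf 1}=\Theta_\emptyset^{(1)}=2M_\emptyset^{(1)}$. For a word $w$ in letters $\mathbf c,\mathbf d$ of degrees $1,2$, let $|w|_{\mathbf c}$ be the number of $\mathbf c$'s in $w$, let $\widehat w$ be the operator on $\mathcal Q$ obtained from $w$ by replacing $\mathbf c$ by multiplication by $\Theta_{\mathbf 1}$ and $\mathbf d$ by $L^2=L\circ L$ and composing (so $\widehat{\mathbf 1}$ is the identity for the empty word $\mathbf 1$), and let $\Omega_w=\widehat w(\Theta_{\mathbf 1})$. **Theorem.** Every operator $\widehat w$ maps $\Pi$ to $\Pi$; in particular $\Omega_w\in\Pi$. The map $\vartheta$ is diagonalizable on $\Pi$: $\Pi$ is spanned by eigenvectors of $\vartheta|_\Pi$.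 The $\Omega_w$ form a complete set of eigenvectors: each $\Omega_w$ is an eigenvector of $\vartheta$ with eigenvalue $2^{|w|_{\mathbf c}+1}$; for each $n\ge0$ the $\Omega_w$ with $\deg w=n$ form a basis of $\Pi_{n+1}$; and all the $\Omega_w$, together with the constant $1$ spanning $\Pi_0$, form a basis of $\Pi$. For each $n\ge0$, $\vartheta$ maps $\Pi_{n+1}$ to itself, and the eigenvalues of $\vartheta$ on $\Pi_{n+1}$ are exactly the numbers $2^{n+1-2k}$, $0\le k\le\lfloor n/2\rfloor$. -/

import Mathlib

noncomputable section

namespace PeakAlgebra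

/-! ### Quasisymmetric functions -/

/-- The list of nonzero exponents of a monomial, read in the order of the variables:
for `x_{i_1}^{b_1} ⋯ x_{i_k}^{b_k}` with `i_1 < ⋯ < i_k` and all `b_j > 0` it is
`[b_1, …, b_k]`. -/
def exps {σ : Type*} [LinearOrder σ] (m : σ →₀ ℕ) : List ℕ := m.support.sort.map m

theorem exps_embDomain {σ τ : Type*} [LinearOrder σ] [LinearOrder τ] (i : σ ↪o τ)
    (m : σ →₀ ℕ) : exps (m.embDomain i.toEmbedding) = exps m := by
  unfold exps
  rw [Finsupp.support_embDomain, ← Finset.map_sort i.toEmbedding m.support (· ≤ ·) (· ≤ ·)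
    (fun _ _ _ _ => i.le_iff_le.symm), List.map_map]
  apply List.map_congr_left
  intro a _
  exact Finsupp.embDomain_apply_self _ _ _

theorem sum_exps {σ : Type*} [LinearOrder σ] (m : σ →₀ ℕ) : (exps m).sum = m.degree := by
  rw [Finsupp.degree_apply, exps, ← List.sum_toFinset m (Finset.sort_nodup _ _),
    Finset.sort_toFinset]

theorem pos_of_mem_exps {σ : Type*} [LinearOrder σ] (m : σ →₀ ℕ) :
    ∀ b ∈ exps m, 0 < b := by
  intro b hb
  simp only [exps, List.mem_map, Finset.mem_sort, Finsupp.mem_support_iff] at hb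
  obtain ⟨a, ha, rfl⟩ := hb
  omega

/-- The monomial `x_1^{b_1} ⋯ x_k^{b_k}` has exponent list `[b_1, …, b_k]`. -/
theorem exps_toFinsupp (β : List ℕ) (hβ : ∀ b ∈ β, 0 < b) : exps β.toFinsupp = β := by
  have hs : β.toFinsupp.support = Finset.range β.length := by
    ext i
    simp only [Finsupp.mem_support_iff, List.toFinsupp_apply, Finset.mem_range]
    constructor
    · intro h
      by_contra hi
      exact h (List.getD_eq_default _ _ (by omega))
    · intro hi
      rw [List.getD_eq_getElem _ _ hi]
      exact (hβ _ (List.getElem_mem hi)).ne'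
  unfold exps
  rw [hs, Finset.sort_range]
  apply List.ext_getElem
  · simp
  · intro i h1 h2
    simp [h2]

/-- A power series in `x_1, x_2, …` is quasisymmetric if, for all `i_1 < ⋯ < i_k` and all
positive exponents, its coefficient at `x_{i_1}^{b_1} ⋯ x_{i_k}^{b_k}` equals its
coefficient at `x_1^{b_1} ⋯ x_k^{b_k}`; that is, the coefficient only depends on the
list of nonzero exponents. -/
def IsQuasisymmetric (f : MvPowerSeries ℕ ℚ) : Prop :=
  ∀ m m' : ℕ →₀ ℕ, exps m = exps m' → MvPowerSeries.coeff m f = MvPowerSeries.coeff m' f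

def HasBoundedDegree (f : MvPowerSeries ℕ ℚ) : Prop :=
  ∃ d : ℕ, ∀ m : ℕ →₀ ℕ, MvPowerSeries.coeff m f ≠ 0 → m.degree ≤ d

theorem exists_common (m m' : ℕ →₀ ℕ) (h : exps m = exps m') :
    ∃ (k : ℕ) (i i' : Fin k ↪o ℕ) (β : Fin k →₀ ℕ),
      m = β.embDomain i.toEmbedding ∧ m' = β.embDomain i'.toEmbedding := by
  have hc : m'.support.card = m.support.card := by
    have := congrArg List.length h
    simpa [exps] using this.symm
  set i := m.support.orderEmbOfFin rfl with hi
  set i' := m'.support.orderEmbOfFin hc with hi'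
  have key : ∀ j, m (i j) = m' (i' j) := by
    intro j
    have h1 : m (i j) = (exps m)[(j : ℕ)]'(by simp [exps]) := by
      simp [exps, hi, Finset.orderEmbOfFin_apply]
    have h2 : m' (i' j) = (exps m')[(j : ℕ)]'(by simp [exps, hc]) := by
      simp [exps, hi', Finset.orderEmbOfFin_apply]
    rw [h1, h2]
    simp only [h]
  have aux : ∀ (n : ℕ →₀ ℕ) (e : Fin m.support.card ↪o ℕ)
      (_ : Set.range e = (n.support : Set ℕ)) (_ : ∀ j, n (e j) = m (i j)),
      n = (Finsupp.equivFunOnFinite.symm fun j => m (i j)).embDomain e.toEmbedding := by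
    intro n e he hv
    ext a
    by_cases ha : a ∈ Set.range e
    · obtain ⟨j, rfl⟩ := ha
      have := Finsupp.embDomain_apply_self e.toEmbedding
        (Finsupp.equivFunOnFinite.symm fun j => m (i j)) j
      rw [show e j = e.toEmbedding j from rfl, this]
      exact hv j
    · rw [Finsupp.embDomain_of_notMem_range _ _ _ ha]
      rw [he] at ha
      simpa using ha
  exact ⟨_, i, i', Finsupp.equivFunOnFinite.symm fun j => m (i j),
    aux m i (by simp [hi]) (fun _ => rfl), aux m' i' (by simp [hi']) (fun j => (key j).symm)⟩

theorem sum_antidiagonal_embDomain {k : ℕ} (i : Fin k ↪o ℕ) (β : Fin k →₀ ℕ)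
    (g : (ℕ →₀ ℕ) × (ℕ →₀ ℕ) → ℚ) :
    ∑ p ∈ Finset.HasAntidiagonal.antidiagonal (β.embDomain i.toEmbedding), g p =
      ∑ p ∈ Finset.HasAntidiagonal.antidiagonal β,
        g (p.1.embDomain i.toEmbedding, p.2.embDomain i.toEmbedding) := by
  symm
  refine Finset.sum_bij
    (fun p _ => (p.1.embDomain i.toEmbedding, p.2.embDomain i.toEmbedding)) ?_ ?_ ?_ ?_
  · intro p hp
    rw [Finset.HasAntidiagonal.mem_antidiagonal] at hp ⊢
    rw [← hp, Finsupp.embDomain_eq_mapDomain, Finsupp.embDomain_eq_mapDomain,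
      Finsupp.embDomain_eq_mapDomain, Finsupp.mapDomain_add]
  · intro p _ q _ h
    simp only [Prod.mk.injEq] at h
    exact Prod.ext (Finsupp.embDomain_injective _ h.1) (Finsupp.embDomain_injective _ h.2)
  · rintro ⟨a, b⟩ hab
    rw [Finset.HasAntidiagonal.mem_antidiagonal] at hab
    simp only at hab
    have hinj : ∀ c : ℕ →₀ ℕ, (∀ x, c x ≤ β.embDomain i.toEmbedding x) →
        (c.comapDomain i.toEmbedding i.toEmbedding.injective.injOn).embDomain
          i.toEmbedding = c := by
      intro c hc
      ext x
      by_cases hx : x ∈ Set.range i.toEmbedding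
      · obtain ⟨j, rfl⟩ := hx
        rw [Finsupp.embDomain_apply_self]; rfl
      · rw [Finsupp.embDomain_of_notMem_range _ _ _ hx]
        have := hc x
        rw [Finsupp.embDomain_of_notMem_range _ _ _ hx] at this
        omega
    have ha := hinj a (fun x => by rw [← hab]; simp)
    have hb := hinj b (fun x => by rw [← hab]; simp)
    refine ⟨(_, _), ?_, Prod.ext ha hb⟩
    rw [Finset.HasAntidiagonal.mem_antidiagonal]
    apply Finsupp.embDomain_injective i.toEmbedding
    rw [Finsupp.embDomain_eq_mapDomain, Finsupp.mapDomain_add,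
      ← Finsupp.embDomain_eq_mapDomain, ← Finsupp.embDomain_eq_mapDomain]
    exact (congrArg₂ (· + ·) ha hb).trans hab
  · intro _ _; rfl

/-- The algebra of quasisymmetric functions over `ℚ`. -/
def QSym : Subalgebra ℚ (MvPowerSeries ℕ ℚ) where
  carrier := {f | HasBoundedDegree f ∧ IsQuasisymmetric f}
  mul_mem' := by
    rintro f g ⟨⟨d, hd⟩, hf⟩ ⟨⟨e, he⟩, hg⟩
    refine ⟨⟨d + e, fun m hm => ?_⟩, fun m m' h => ?_⟩
    · rw [MvPowerSeries.coeff_mul] at hm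
      obtain ⟨p, hp, hne⟩ := Finset.exists_ne_zero_of_sum_ne_zero hm
      rw [Finset.HasAntidiagonal.mem_antidiagonal] at hp
      rw [← hp, map_add]
      exact add_le_add (hd _ (left_ne_zero_of_mul hne)) (he _ (right_ne_zero_of_mul hne))
    · obtain ⟨k, i, i', β, rfl, rfl⟩ := exists_common m m' h
      rw [MvPowerSeries.coeff_mul, MvPowerSeries.coeff_mul, sum_antidiagonal_embDomain,
        sum_antidiagonal_embDomain]
      refine Finset.sum_congr rfl fun p _ => ?_
      rw [hf _ (p.1.embDomain i'.toEmbedding) (by simp only [exps_embDomain]),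
        hg _ (p.2.embDomain i'.toEmbedding) (by simp only [exps_embDomain])]
  add_mem' := by
    rintro f g ⟨⟨d, hd⟩, hf⟩ ⟨⟨e, he⟩, hg⟩
    refine ⟨⟨max d e, fun m hm => ?_⟩, fun m m' h => ?_⟩
    · rw [map_add] at hm
      by_cases h0 : MvPowerSeries.coeff m f = 0
      · rw [h0, zero_add] at hm
        exact (he m hm).trans (le_max_right _ _)
      · exact (hd m h0).trans (le_max_left _ _)
    · rw [map_add, map_add, hf m m' h, hg m m' h]
  algebraMap_mem' := by
    intro r
    have hc : ∀ m : ℕ →₀ ℕ, MvPowerSeries.coeff m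
        (algebraMap ℚ (MvPowerSeries ℕ ℚ) r) = if m.degree = 0 then r else 0 := by
      intro m
      rw [MvPowerSeries.algebraMap_apply, MvPowerSeries.coeff_C]
      simp only [Finsupp.degree_eq_zero_iff, Algebra.algebraMap_self, RingHom.id_apply]
    refine ⟨⟨0, fun m hm => ?_⟩, fun m m' h => ?_⟩
    · rw [hc] at hm
      by_contra hne
      exact hm (if_neg (by omega))
    · rw [hc, hc, ← sum_exps, ← sum_exps, h]

/-- The monomial quasisymmetric function
`M_β = ∑_{i_1 < ⋯ < i_k} x_{i_1}^{β_1} ⋯ x_{i_k}^{β_k}` of a list of positive integers: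
the sum of all monomials whose list of nonzero exponents is `β`. -/
def monoSeries (β : List ℕ) : MvPowerSeries ℕ ℚ := fun m => if exps m = β then 1 else 0

theorem coeff_monoSeries (β : List ℕ) (m : ℕ →₀ ℕ) :
    MvPowerSeries.coeff m (monoSeries β) = if exps m = β then 1 else 0 := rfl

theorem monoSeries_mem (β : List ℕ) : monoSeries β ∈ QSym := by
  refine ⟨⟨β.sum, fun m hm => ?_⟩, fun m m' h => ?_⟩
  · rw [coeff_monoSeries] at hm
    by_cases h : exps m = β
    · rw [← sum_exps, h]
    · simp [h] at hm
  · rw [coeff_monoSeries, coeff_monoSeries, h]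

/-- Successive differences of the list `a :: l`. -/
def gaps : ℕ → List ℕ → List ℕ
  | _, [] => []
  | a, b :: l => (b - a) :: gaps b l

/-- For `S = {i_1 < ⋯ < i_k} ⊆ [n]`, the composition
`β(S) = (i_1, i_2 - i_1, …, i_k - i_{k-1}, n + 1 - i_k)` of `n + 1`. -/
def comp (n : ℕ) (S : Finset ℕ) : List ℕ := gaps 0 (S.sort ++ [n + 1])

/-- `M n S` is `M_S^{(n+1)} = M_{β(S)}`, for `S ⊆ [n]`. -/
def M (n : ℕ) (S : Finset ℕ) : QSym := ⟨monoSeries (comp n S), monoSeries_mem _⟩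

/-- `F_S^{(n+1)} = ∑_{S ⊆ T ⊆ [n]} M_T^{(n+1)}`, for `S ⊆ [n]`. -/
def F (n : ℕ) (S : Finset ℕ) : QSym :=
  ∑ T ∈ (Finset.Icc 1 n).powerset with S ⊆ T, M n T

/-! ### The bases `M_S` and `F_S` (together with `1` in degree `0`) -/

/-- `none` stands for the basis element `1` of degree `0`, and `some ⟨n, S⟩` for
the subset `S` of `[n]`, which indexes basis elements of degree `n + 1`. -/
abbrev Index : Type := Option (Σ n : ℕ, {S : Finset ℕ // S ⊆ Finset.Icc 1 n})

def listOf : Index → List ℕ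
  | none => []
  | some ⟨n, S⟩ => comp n S.1

theorem gaps_pos (l : List ℕ) : ∀ a, (a :: l).Pairwise (· < ·) → ∀ b ∈ gaps a l, 0 < b := by
  induction l with
  | nil => intro a _ b hb; simp [gaps] at hb
  | cons c l ih =>
    intro a h b hb
    simp only [gaps, List.mem_cons] at hb
    rcases hb with rfl | hb
    · have := (List.pairwise_cons.1 h).1 c (by simp)
      omega
    · exact ih c (List.pairwise_cons.1 h).2 b hb

theorem gaps_inj (l : List ℕ) : ∀ (l' : List ℕ) (a : ℕ), (a :: l).Pairwise (· < ·) →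
    (a :: l').Pairwise (· < ·) → gaps a l = gaps a l' → l = l' := by
  induction l with
  | nil => intro l' a _ _ h; cases l' with
    | nil => rfl
    | cons _ _ => simp [gaps] at h
  | cons c l ih =>
    intro l' a h1 h2 h
    cases l' with
    | nil => simp [gaps] at h
    | cons c' l' =>
      simp only [gaps, List.cons.injEq] at h
      have e1 := (List.pairwise_cons.1 h1).1 c (by simp)
      have e2 := (List.pairwise_cons.1 h2).1 c' (by simp)
      have : c = c' := by omega
      subst this
      rw [ih l' c (List.pairwise_cons.1 h1).2 (List.pairwise_cons.1 h2).2 h.2]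

theorem gaps_surj (β : List ℕ) : ∀ a, (∀ b ∈ β, 0 < b) → β ≠ [] →
    ∃ l : List ℕ, (a :: (l ++ [a + β.sum])).Pairwise (· < ·) ∧
      gaps a (l ++ [a + β.sum]) = β := by
  induction β with
  | nil => intro a _ h; exact absurd rfl h
  | cons c β ih =>
    intro a hp _
    have hc := hp c (by simp)
    by_cases hβ : β = []
    · subst hβ
      exact ⟨[], by simpa using hc, by simp [gaps]⟩
    · obtain ⟨l, h1, h2⟩ := ih (a + c) (fun b hb => hp b (by simp [hb])) hβ
      refine ⟨(a + c) :: l, ?_, ?_⟩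
      · rw [List.sum_cons, ← add_assoc, List.cons_append, List.pairwise_cons]
        refine ⟨?_, h1⟩
        intro b hb
        rcases List.mem_cons.1 hb with rfl | hb
        · omega
        · have := (List.pairwise_cons.1 h1).1 b hb
          omega
      · rw [List.sum_cons, ← add_assoc, List.cons_append, gaps, h2]
        simp

theorem pairwise_sort_append {n : ℕ} {S : Finset ℕ} (hS : S ⊆ Finset.Icc 1 n) :
    (0 :: (S.sort ++ [n + 1])).Pairwise (· < ·) := by
  rw [List.pairwise_cons, List.pairwise_append]
  refine ⟨fun b hb => ?_, S.sortedLT_sort.pairwise, by simp, fun a ha b hb => ?_⟩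
  · rcases List.mem_append.1 hb with hb | hb
    · have := Finset.mem_Icc.1 (hS ((Finset.mem_sort _).1 hb)); omega
    · simp at hb; omega
  · have := Finset.mem_Icc.1 (hS ((Finset.mem_sort _).1 ha))
    simp at hb; omega

theorem gaps_sum (l : List ℕ) (c : ℕ) : ∀ a, (a :: (l ++ [c])).Pairwise (· < ·) →
    (gaps a (l ++ [c])).sum = c - a := by
  induction l with
  | nil => intro a _; simp [gaps]
  | cons b l ih =>
    intro a h
    have h' := List.pairwise_cons.1 h
    have e1 := h'.1 b (by simp)
    have e2 := (List.pairwise_cons.1 h'.2).1 c (by simp)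
    rw [List.cons_append, gaps, List.sum_cons, ih b h'.2]
    omega

theorem comp_sum {n : ℕ} {S : Finset ℕ} (hS : S ⊆ Finset.Icc 1 n) :
    (comp n S).sum = n + 1 := by
  rw [comp, gaps_sum _ _ _ (pairwise_sort_append hS)]; rfl

theorem comp_ne_nil (n : ℕ) (S : Finset ℕ) : comp n S ≠ [] := by
  unfold comp
  cases S.sort <;> simp [gaps]

theorem listOf_injective : Function.Injective listOf := by
  rintro (_ | ⟨n, S, hS⟩) (_ | ⟨n', S', hS'⟩) h
  · rfl
  · exact absurd h.symm (comp_ne_nil _ _)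
  · exact absurd h (comp_ne_nil _ _)
  · have hn : n = n' := by
      have h1 := congrArg List.sum h
      simp only [listOf] at h1
      rw [comp_sum hS, comp_sum hS'] at h1
      omega
    subst hn
    have h2 := gaps_inj _ _ 0 (pairwise_sort_append hS) (pairwise_sort_append hS') h
    have h3 := List.append_cancel_right h2
    have h4 : S = S' := by rw [← Finset.sort_toFinset S (· ≤ ·), h3, Finset.sort_toFinset]
    subst h4
    rfl

theorem listOf_pos (i : Index) : ∀ b ∈ listOf i, 0 < b := by
  rcases i with _ | ⟨n, S, hS⟩
  · intro b hb; simp [listOf] at hb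
  · exact gaps_pos _ _ (pairwise_sort_append hS)

theorem listOf_surj (β : List ℕ) (hβ : ∀ b ∈ β, 0 < b) : ∃ i, listOf i = β := by
  by_cases h : β = []
  · exact ⟨none, h.symm⟩
  · obtain ⟨l, h1, h2⟩ := gaps_surj β 0 hβ h
    have hs : 0 < β.sum := by
      have := (List.pairwise_cons.1 h1).1 (0 + β.sum) (by simp)
      omega
    have h1' := List.pairwise_cons.1 h1
    have h3 := List.pairwise_append.1 h1'.2
    have hl : l.toFinset.sort = l :=
      (List.toFinset_sort (· ≤ ·) (h3.1.imp (fun h => h.ne))).2 (h3.1.imp (fun h => h.le))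
    refine ⟨some ⟨β.sum - 1, l.toFinset, ?_⟩, ?_⟩
    · intro a ha
      rw [List.mem_toFinset] at ha
      have e1 := h1'.1 a (by simp [ha])
      have e2 := h3.2.2 a ha (0 + β.sum) (by simp)
      rw [Finset.mem_Icc]; omega
    · change gaps 0 (l.toFinset.sort ++ [β.sum - 1 + 1]) = β
      rw [hl, Nat.sub_add_cancel hs]
      simpa using h2

def MFamily : Index → QSym
  | none => 1
  | some ⟨n, S⟩ => M n S.1

theorem coeff_MFamily (i : Index) (m : ℕ →₀ ℕ) :
    MvPowerSeries.coeff m (MFamily i : MvPowerSeries ℕ ℚ) =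
      if exps m = listOf i then 1 else 0 := by
  rcases i with _ | ⟨n, S⟩
  · change MvPowerSeries.coeff m (1 : MvPowerSeries ℕ ℚ) = _
    rw [MvPowerSeries.coeff_one]
    have : m = 0 ↔ exps m = [] := by
      rw [← List.length_eq_zero_iff, exps, List.length_map, Finset.length_sort,
        Finset.card_eq_zero, Finsupp.support_eq_empty]
    change (if m = 0 then (1 : ℚ) else 0) = if exps m = [] then 1 else 0
    by_cases h : m = 0
    · rw [if_pos h, if_pos (this.1 h)]
    · rw [if_neg h, if_neg (fun h' => h (this.2 h'))]
  · rfl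

/-- The coefficient functional that reads off the coordinate of index `i`. -/
def coordM (i : Index) : QSym →ₗ[ℚ] ℚ :=
  (MvPowerSeries.coeff (listOf i).toFinsupp) ∘ₗ QSym.val.toLinearMap

theorem coordM_MFamily (i j : Index) : coordM i (MFamily j) = if i = j then 1 else 0 := by
  change MvPowerSeries.coeff _ (MFamily j : MvPowerSeries ℕ ℚ) = _
  rw [coeff_MFamily, exps_toFinsupp _ (listOf_pos i)]
  simp only [listOf_injective.eq_iff]

theorem MFamily_linearIndependent : LinearIndependent ℚ MFamily := by
  rw [linearIndependent_iff]
  intro l hl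
  ext i
  have := congrArg (coordM i) hl
  rw [Finsupp.linearCombination_apply, Finsupp.sum, map_sum, map_zero] at this
  simp only [map_smul, coordM_MFamily, smul_eq_mul, mul_ite, mul_one, mul_zero] at this
  rw [Finset.sum_ite_eq] at this
  by_cases h : i ∈ l.support
  · simpa [h] using this
  · simpa using h

theorem MFamily_span : ⊤ ≤ Submodule.span ℚ (Set.range MFamily) := by
  intro f _
  obtain ⟨⟨d, hd⟩, hq⟩ := f.2
  let A : Finset Index := insert none (((Finset.range d).sigma
    (fun n => (Finset.Icc 1 n).powerset.subtype (fun S => S ⊆ Finset.Icc 1 n))).map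
      Function.Embedding.some)
  have hf : f = ∑ i ∈ A, coordM i f • MFamily i := by
    apply Subtype.ext
    apply MvPowerSeries.ext
    intro m
    have e : MvPowerSeries.coeff m
        ((∑ i ∈ A, coordM i f • MFamily i : QSym) : MvPowerSeries ℕ ℚ) =
        ∑ i ∈ A, coordM i f * (if exps m = listOf i then 1 else 0) := by
      change ((MvPowerSeries.coeff m) ∘ₗ QSym.val.toLinearMap)
        (∑ i ∈ A, coordM i f • MFamily i) = _
      rw [map_sum]
      refine Finset.sum_congr rfl fun i _ => ?_
      rw [map_smul, smul_eq_mul, ← coeff_MFamily]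
      rfl
    rw [e]
    obtain ⟨i, hi⟩ := listOf_surj (exps m) (pos_of_mem_exps m)
    simp only [← hi, listOf_injective.eq_iff, mul_ite, mul_one, mul_zero]
    rw [Finset.sum_ite_eq]
    have hc : coordM i f = MvPowerSeries.coeff m (f : MvPowerSeries ℕ ℚ) :=
      hq _ _ (by rw [hi, exps_toFinsupp _ (pos_of_mem_exps m)])
    rw [hc]
    split_ifs with hA
    · rfl
    · by_contra hne
      apply hA
      have hdeg := hd m hne
      rcases i with _ | ⟨n, S, hS⟩
      · exact Finset.mem_insert_self _ _
      · rw [← sum_exps, ← hi] at hdeg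
        simp only [listOf] at hdeg
        rw [comp_sum hS] at hdeg
        refine Finset.mem_insert_of_mem (Finset.mem_map_of_mem Function.Embedding.some ?_)
        rw [Finset.mem_sigma]
        exact ⟨Finset.mem_range.2 (by simp only; omega), by simpa using hS⟩
  rw [hf]
  exact Submodule.sum_mem _ fun i _ =>
    Submodule.smul_mem _ _ (Submodule.subset_span ⟨i, rfl⟩)

/-- The basis of `QSym` consisting of `1` and the `M_S^{(n+1)}`, `S ⊆ [n]`, `n ≥ 0`. -/
def basisM : Module.Basis Index ℚ QSym :=
  Module.Basis.mk MFamily_linearIndependent MFamily_span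

theorem basisM_some (n : ℕ) (S : Finset ℕ) (hS : S ⊆ Finset.Icc 1 n) :
    basisM (some ⟨n, S, hS⟩) = M n S := by
  simp [basisM, MFamily]

theorem basisM_none : basisM none = 1 := by
  simp [basisM, MFamily]

def FFamily : Index → QSym
  | none => 1
  | some ⟨n, S⟩ => F n S.1

/-- The linear map `1 ↦ 1`, `M_S ↦ F_S`. -/
def upMap : QSym →ₗ[ℚ] QSym := basisM.constr ℚ FFamily

/-- The linear map `1 ↦ 1`, `M_S ↦ (-1)^{|S|} M_S`. -/
def signMap : QSym →ₗ[ℚ] QSym := basisM.constr ℚ fun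
  | none => 1
  | some ⟨n, S⟩ => (-1 : ℚ) ^ S.1.card • M n S.1

theorem upMap_one : upMap 1 = 1 := by
  have h := basisM.constr_basis ℚ FFamily none
  rwa [basisM_none] at h

theorem upMap_M (n : ℕ) (S : Finset ℕ) (hS : S ⊆ Finset.Icc 1 n) :
    upMap (M n S) = F n S := by
  have h := basisM.constr_basis ℚ FFamily (some ⟨n, S, hS⟩)
  rwa [basisM_some] at h

theorem signMap_one : signMap 1 = 1 := by
  rw [← basisM_none, signMap, Module.Basis.constr_basis]
  exact basisM_none.symm

theorem signMap_M (n : ℕ) (S : Finset ℕ) (hS : S ⊆ Finset.Icc 1 n) :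
    signMap (M n S) = (-1 : ℚ) ^ S.card • M n S := by
  conv_lhs => rw [← basisM_some n S hS, signMap, Module.Basis.constr_basis]

theorem signMap_F (n : ℕ) (S : Finset ℕ) :
    signMap (F n S) = ∑ T ∈ (Finset.Icc 1 n).powerset with S ⊆ T,
      (-1 : ℚ) ^ T.card • M n T := by
  rw [F, map_sum]
  refine Finset.sum_congr rfl fun T hT => signMap_M n T ?_
  simpa using (Finset.mem_filter.1 hT).1

theorem signMap_signMap (f : QSym) : signMap (signMap f) = f := by
  have : signMap ∘ₗ signMap = LinearMap.id := by
    apply basisM.ext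
    rintro (_ | ⟨n, S, hS⟩)
    · rw [basisM_none]; simp [signMap_one]
    · rw [basisM_some]
      simp [signMap_M n S hS, smul_smul, ← mul_pow]
  exact LinearMap.congr_fun this f

theorem signed_interval_sum (n : ℕ) (S T : Finset ℕ) (hT : T ⊆ Finset.Icc 1 n) (hST : S ⊆ T) :
    ∑ U ∈ (Finset.Icc 1 n).powerset with (S ⊆ U ∧ U ⊆ T), (-1 : ℚ) ^ U.card =
      if S = T then (-1 : ℚ) ^ T.card else 0 := by
  have h1 : ∑ U ∈ (Finset.Icc 1 n).powerset with (S ⊆ U ∧ U ⊆ T), (-1 : ℚ) ^ U.card =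
      ∑ V ∈ (T \ S).powerset, (-1 : ℚ) ^ S.card * (-1 : ℚ) ^ V.card := by
    symm
    refine Finset.sum_bij (fun V _ => S ∪ V) ?_ ?_ ?_ ?_
    · intro V hV
      rw [Finset.mem_powerset] at hV
      have : S ∪ V ⊆ T := Finset.union_subset hST (hV.trans Finset.sdiff_subset)
      simp only [Finset.mem_filter, Finset.mem_powerset]
      exact ⟨this.trans hT, Finset.subset_union_left, this⟩
    · intro V hV W hW h
      rw [Finset.mem_powerset] at hV hW
      have dV : Disjoint S V := (Finset.disjoint_sdiff).mono_right hV
      have dW : Disjoint S W := (Finset.disjoint_sdiff).mono_right hW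
      rw [← Finset.union_sdiff_cancel_left dV, h, Finset.union_sdiff_cancel_left dW]
    · intro U hU
      simp only [Finset.mem_filter, Finset.mem_powerset] at hU
      exact ⟨U \ S, Finset.mem_powerset.2 (Finset.sdiff_subset_sdiff hU.2.2 le_rfl),
        Finset.union_sdiff_of_subset hU.2.1⟩
    · intro V hV
      rw [Finset.mem_powerset] at hV
      have dV : Disjoint S V := (Finset.disjoint_sdiff).mono_right hV
      rw [Finset.card_union_of_disjoint dV, pow_add]
  rw [h1, ← Finset.mul_sum]
  have h2 := Finset.sum_powerset_neg_one_pow_card (x := T \ S)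
  have h3 : ∑ V ∈ (T \ S).powerset, (-1 : ℚ) ^ V.card = if T \ S = ∅ then 1 else 0 := by
    exact_mod_cast congrArg (Int.cast : ℤ → ℚ) h2
  rw [h3]
  by_cases h : S = T
  · subst h; simp
  · rw [if_neg h, if_neg, mul_zero]
    intro h'
    exact h (Finset.Subset.antisymm hST (Finset.sdiff_eq_empty_iff_subset.1 h'))

theorem up_sign_up_sign (f : QSym) : upMap (signMap (upMap (signMap f))) = f := by
  have : upMap ∘ₗ signMap ∘ₗ upMap ∘ₗ signMap = LinearMap.id := by
    apply basisM.ext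
    rintro (_ | ⟨n, S, hS⟩)
    · rw [basisM_none]; simp [signMap_one, upMap_one]
    · rw [basisM_some]
      simp only [LinearMap.comp_apply, LinearMap.id_apply]
      rw [signMap_M n S hS, map_smul, upMap_M n S hS, map_smul, signMap_F, map_smul, map_sum]
      have e : ∀ U ∈ (Finset.Icc 1 n).powerset.filter (S ⊆ ·),
          upMap ((-1 : ℚ) ^ U.card • M n U) =
            ∑ T ∈ (Finset.Icc 1 n).powerset, if U ⊆ T then (-1 : ℚ) ^ U.card • M n T else 0 := by
        intro U hU
        have hU' : U ⊆ Finset.Icc 1 n := by simpa using (Finset.mem_filter.1 hU).1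
        rw [map_smul, upMap_M n U hU', F, Finset.smul_sum, Finset.sum_filter]
      rw [Finset.sum_congr rfl e, Finset.sum_comm]
      have e2 : ∀ T ∈ (Finset.Icc 1 n).powerset,
          (∑ U ∈ (Finset.Icc 1 n).powerset.filter (S ⊆ ·),
            if U ⊆ T then (-1 : ℚ) ^ U.card • M n T else 0) =
          if S = T then (-1 : ℚ) ^ T.card • M n T else 0 := by
        intro T hT
        rw [Finset.mem_powerset] at hT
        rw [← Finset.sum_filter, Finset.filter_filter, ← Finset.sum_smul]
        by_cases hST : S ⊆ T
        · rw [signed_interval_sum n S T hT hST]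
          split_ifs <;> simp
        · rw [Finset.filter_false_of_mem (fun U _ h => hST (h.1.trans h.2)),
            if_neg (fun h => hST h.subset)]
          simp
      rw [Finset.sum_congr rfl e2, Finset.sum_ite_eq, if_pos (Finset.mem_powerset.2 hS),
        smul_smul, ← mul_pow]
      simp
  exact LinearMap.congr_fun this f

def upEquiv : QSym ≃ₗ[ℚ] QSym :=
  LinearEquiv.ofLinearMap upMap (signMap ∘ₗ upMap ∘ₗ signMap)
    (LinearMap.ext fun f => up_sign_up_sign f)
    (LinearMap.ext fun f => by
      have h := congrArg signMap (up_sign_up_sign (signMap f))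
      rw [signMap_signMap] at h
      exact h)

/-- The basis of `QSym` consisting of `1` and the `F_S^{(n+1)}`, `S ⊆ [n]`, `n ≥ 0`. -/
def basisF : Module.Basis Index ℚ QSym := basisM.map upEquiv

theorem basisF_none : basisF none = 1 := by
  rw [basisF, Module.Basis.map_apply, basisM_none]
  exact upMap_one

theorem basisF_some (n : ℕ) (S : Finset ℕ) (hS : S ⊆ Finset.Icc 1 n) :
    basisF (some ⟨n, S, hS⟩) = F n S := by
  rw [basisF, Module.Basis.map_apply, basisM_some]
  exact upMap_M n S hS

/-! ### The peak algebra and the Stembridge map -/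

/-- `S` is left sparse: `1 ∉ S`, and `i ∈ S` implies `i - 1 ∉ S` (for sets of positive
integers). -/
def LeftSparse (S : Finset ℕ) : Prop := 1 ∉ S ∧ ∀ i ∈ S, i - 1 ∉ S

/-- `Θ_S = ∑ 2^{|T|+1} M_T^{(n+1)}`, the sum over all `T ⊆ [n]` with `S ⊆ T ∪ (T + 1)`. -/
def Theta (n : ℕ) (S : Finset ℕ) : QSym :=
  ∑ T ∈ (Finset.Icc 1 n).powerset with S ⊆ T ∪ T.image (· + 1), (2 : ℚ) ^ (T.card + 1) • M n T

/-- The peak algebra `Π`, the unital algebra of quasisymmetric functions generated by all `Θ_S`, where `S` is a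
left sparse subset of `[n]` and `n ≥ 0`. -/
def Peak : Subalgebra ℚ (MvPowerSeries ℕ ℚ) :=
  Algebra.adjoin ℚ {f | ∃ n S, S ⊆ Finset.Icc 1 n ∧ LeftSparse S ∧ f = Theta n S}

theorem peak_le_qsym : Peak ≤ QSym := by
  refine Algebra.adjoin_le ?_
  rintro f ⟨n, S, _, _, rfl⟩
  exact (Theta n S).2

/-- `Π_d`, the elements of `Π` that are homogeneous of degree `d`. -/
def PeakDeg (d : ℕ) : Submodule ℚ Peak where
  carrier := {f | (f : MvPowerSeries ℕ ℚ).IsHomogeneous d}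
  add_mem' := by
    intro f g hf hg m hm
    by_cases h0 : MvPowerSeries.coeff m (f : MvPowerSeries ℕ ℚ) = 0
    · refine hg ?_
      intro h1
      apply hm
      change MvPowerSeries.coeff m ((f : MvPowerSeries ℕ ℚ) + (g : MvPowerSeries ℕ ℚ)) = 0
      rw [map_add, h0, h1, add_zero]
    · exact hf h0
  zero_mem' := by
    intro m hm
    exact absurd (map_zero (MvPowerSeries.coeff m)) hm
  smul_mem' := by
    intro c f hf m hm
    refine hf ?_
    intro h1
    apply hm
    change MvPowerSeries.coeff m (c • (f : MvPowerSeries ℕ ℚ)) = 0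
    rw [map_smul, h1, smul_zero]

/-- `Λ(S) = {i ∈ S | i ≠ 1, i - 1 ∉ S}`. -/
def Lam (S : Finset ℕ) : Finset ℕ := S.filter fun i => i ≠ 1 ∧ i - 1 ∉ S

theorem theta_lam_mem (n : ℕ) (S : Finset ℕ) (hS : S ⊆ Finset.Icc 1 n) :
    (Theta n (Lam S) : MvPowerSeries ℕ ℚ) ∈ Peak := by
  refine Algebra.subset_adjoin ⟨n, Lam S, (Finset.filter_subset _ _).trans hS, ?_, rfl⟩
  constructor
  · intro h
    exact (Finset.mem_filter.1 h).2.1 rfl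
  · intro i hi h
    exact (Finset.mem_filter.1 hi).2.2 (Finset.mem_filter.1 h).1

/-- The Stembridge map `ϑ : QSym → Π`, the linear map with `ϑ(1) = 1` and
`ϑ(F_S) = Θ_{Λ(S)}` for all `S ⊆ [n]`, `n ≥ 0`. -/
def stembridge : QSym →ₗ[ℚ] Peak := basisF.constr ℚ fun
  | none => 1
  | some ⟨n, S⟩ => ⟨Theta n (Lam S.1), theta_lam_mem n S.1 S.2⟩

theorem stembridge_one : stembridge 1 = 1 := by
  conv_lhs => rw [← basisF_none, stembridge, Module.Basis.constr_basis]

theorem stembridge_F (n : ℕ) (S : Finset ℕ) (hS : S ⊆ Finset.Icc 1 n) :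
    (stembridge (F n S) : MvPowerSeries ℕ ℚ) = Theta n (Lam S) := by
  conv_lhs => rw [← basisF_some n S hS, stembridge, Module.Basis.constr_basis]

/-- The restriction `ϑ : Π → Π`. -/
def stembridgePeak : Module.End ℚ Peak :=
  stembridge ∘ₗ (Subalgebra.inclusion peak_le_qsym).toLinearMap

/-! ### The operators and the eigenvectors -/

/-- The linear map `L : QSym → QSym` with `L(M_S^{(n+1)}) = M_S^{(n+2)}` for `S ⊆ [n]`, `n ≥ 0`
(and `L(1) = 0`). -/
def lift : QSym →ₗ[ℚ] QSym := basisM.constr ℚ fun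
  | none => 0
  | some ⟨n, S⟩ => M (n + 1) S.1

theorem lift_M (n : ℕ) (S : Finset ℕ) (hS : S ⊆ Finset.Icc 1 n) :
    lift (M n S) = M (n + 1) S := by
  conv_lhs => rw [← basisM_some n S hS, lift, Module.Basis.constr_basis]

/-- `Θ_1`, the element `Θ` of the empty word: `S = ∅ ⊆ [0]`. -/
def ThetaOne : QSym := Theta 0 ∅

/-- The two letters of `cd`-words. -/
inductive Letter : Type
  | c : Letter
  | d : Letter

/-- A `cd`-word. -/
abbrev CDWord : Type := List Letter

/-- The degree of a word, where `c` has degree `1` and `d` has degree `2`. -/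
def wordDeg : CDWord → ℕ
  | [] => 0
  | Letter.c :: w => wordDeg w + 1
  | Letter.d :: w => wordDeg w + 2

/-- The number of letters `c` in a word. -/
def cCount : CDWord → ℕ
  | [] => 0
  | Letter.c :: w => cCount w + 1
  | Letter.d :: w => cCount w

/-- The operator `ŵ = w(Θ_1, L²)`: substitute multiplication by `Θ_1` for `c` and `L ∘ L` for
`d`, and read the word as a composition of operators. -/
def wordOp : CDWord → (QSym →ₗ[ℚ] QSym)
  | [] => LinearMap.id
  | Letter.c :: w => LinearMap.mulLeft ℚ ThetaOne ∘ₗ wordOp w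
  | Letter.d :: w => (lift ∘ₗ lift) ∘ₗ wordOp w

/-- `Ω_w = ŵ(Θ_1)`. -/
def Omega (w : CDWord) : QSym := wordOp w ThetaOne

end PeakAlgebra

end

noncomputable section

namespace PeakAlgebra

open Finset Filter

/-! ### Power series as functions on lists of exponents -/

/-! The key is a second description of Π. Encode a quasisymmetric function by its coefficients c(β)
at lists β of exponents, where zeros are immaterial. Call it Eulerian if ∑_{i+j=m} (-1)^j c(α, i, j,
γ) = 0 for all m > 0; equivalently, for every p, putting x_{p+1} = -x_p makes x_p disappear. The
second form shows that the Eulerian functions form an algebra E (`eulerAlgebra`). It contains Θ_S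
for S left sparse, so Π ⊆ E.

On E the Stembridge map is transparent. Checking on the F_S shows that the coefficient of ϑ(f) at β
is the pairing of f with the product over b in β of the noncommutative symmetric functions ∑_{i+j=b}
e_i h_j (`coefs_stembridge`). On E the Euler relations say that e_i acts as h_i, so the coefficient
is the sum of c(i_1, j_1, i_2, j_2, …) over i_k + j_k = β_k. Thus ϑ is there the substitution
x_{2n}, x_{2n+1} ↦ x_n (`stembridge_eq_duplicate`), and in particular multiplicative. The operator
L² adds 2 to the last exponent; because 2 is even, this respects the signs in the Euler relations,
and L² preserves E and commutes with ϑ on it. Since ϑ(Θ_1) = 2Θ_1, every c doubles the eigenvalue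
and every d leaves it unchanged (`stembridge_omega`).

Completeness is a dimension count. The Euler relation at an even exponent contains c(…, m, …) twice
with the same sign and otherwise only longer lists. So an Eulerian function of degree n + 1 is
determined by its values at compositions of n + 1 into odd parts, and these are listed by the
cd-words of degree n (`oddCoefs_injective`). Hence every independent family in E_{n+1} indexed by
those words spans (`eulerDeg_le_span`). This is used twice. For the Θ_S with S the left sparse set
of a word, independence is a triangularity argument, and Π = E follows (`peak_eq_eulerAlgebra`). For
the Ω_w, sort a vanishing combination by first letters as Θ_1 f + L² g = 0. No monomial of L² g ends
with exponent 1, whereas Θ_1 f has such a monomial unless f = 0 (`eq_zero_of_M_mul`); so letters can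
be stripped one by one (`linearIndependent_omega`). The spectrum is then read off the diagonal
basis. -/

/-- The finitely supported function with value `a` at `0` and `x n` at `n + 1`. -/
def fcons (a : ℕ) (x : ℕ →₀ ℕ) : ℕ →₀ ℕ :=
  Finsupp.single 0 a + x.embDomain (addRightEmbedding 1)

theorem fcons_zero (a : ℕ) (x : ℕ →₀ ℕ) : fcons a x 0 = a := by
  have : x.embDomain (addRightEmbedding 1) 0 = 0 :=
    Finsupp.embDomain_of_notMem_range _ _ _ (by simp)
  simp [fcons, this]

theorem fcons_succ (a : ℕ) (x : ℕ →₀ ℕ) (n : ℕ) : fcons a x (n + 1) = x n := by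
  have : x.embDomain (addRightEmbedding 1) (n + 1) = x n :=
    Finsupp.embDomain_apply_self (addRightEmbedding 1) x n
  simp [fcons, this]

theorem fcons_inj {a b : ℕ} {x y : ℕ →₀ ℕ} : fcons a x = fcons b y ↔ a = b ∧ x = y := by
  constructor
  · intro h
    refine ⟨by simpa [fcons_zero] using DFunLike.congr_fun h 0, ?_⟩
    ext n
    simpa [fcons_succ] using DFunLike.congr_fun h (n + 1)
  · rintro ⟨rfl, rfl⟩; rfl

theorem exists_fcons (x : ℕ →₀ ℕ) : ∃ a y, x = fcons a y := by
  refine ⟨x 0, x.comapDomain (· + 1) (add_left_injective 1).injOn, ?_⟩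
  ext n
  cases n with
  | zero => rw [fcons_zero]
  | succ n => rw [fcons_succ]; rfl

theorem toFinsupp_cons (a : ℕ) (l : List ℕ) : (a :: l).toFinsupp = fcons a l.toFinsupp :=
  List.toFinsupp_cons_eq_single_add_embDomain a l

/-- Padding with zeros makes the list as long as desired, so that the exponent of any given variable
is an actual entry. -/
theorem exists_toFinsupp (x : ℕ →₀ ℕ) (N : ℕ) : ∃ l : List ℕ, N ≤ l.length ∧ l.toFinsupp = x := by
  have key : ∀ k, x.support ⊆ range k → ∃ l : List ℕ, l.length = k ∧ l.toFinsupp = x := by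
    intro k hk
    refine ⟨(List.range k).map x, by simp, ?_⟩
    ext i
    rw [List.toFinsupp_apply]
    by_cases hi : i < k
    · simp [hi]
    · have : x i = 0 := by
        by_contra h
        exact hi (mem_range.1 (hk (Finsupp.mem_support_iff.2 h)))
      rw [List.getD_eq_default _ _ (by simpa using hi), this]
  obtain ⟨k, hk⟩ := x.support.exists_nat_subset_range
  obtain ⟨l, h1, h2⟩ := key (max k N) (hk.trans (range_subset_range.2 (le_max_left _ _)))
  exact ⟨l, h1 ▸ le_max_right _ _, h2⟩

theorem exps_toFinsupp_filter (β : List ℕ) : exps β.toFinsupp = β.filter (· ≠ 0) := by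
  have hs : β.toFinsupp.support = (range β.length).filter (fun i => β.getD i 0 ≠ 0) := by
    ext i
    simp only [Finsupp.mem_support_iff, List.toFinsupp_apply, mem_filter, mem_range]
    refine ⟨fun h => ⟨?_, h⟩, fun h => h.2⟩
    by_contra hi
    exact h (List.getD_eq_default _ _ (by omega))
  have hsort : ((range β.length).filter (fun i => β.getD i 0 ≠ 0)).sort =
      (List.range β.length).filter (fun i => β.getD i 0 ≠ 0) := by
    have e : (range β.length).filter (fun i => β.getD i 0 ≠ 0) =
        ((List.range β.length).filter (fun i => β.getD i 0 ≠ 0)).toFinset := by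
      ext i; simp
    rw [e]
    refine (List.toFinset_sort (· ≤ ·) (List.nodup_range.filter _)).2 ?_
    exact (List.pairwise_le_range).filter _
  have hm : (List.range β.length).map (fun i => β.getD i 0) = β := by
    apply List.ext_getElem
    · simp
    · intro i h1 h2
      simp [h2]
  rw [exps, hs, hsort]
  conv_rhs => rw [← hm]
  rw [List.filter_map]
  rfl

/-- The coefficient at `x_0^{β_0} x_1^{β_1} ⋯`, as a function of the list `β`. -/
def coefs : MvPowerSeries ℕ ℚ →ₗ[ℚ] (List ℕ → ℚ) :=
  LinearMap.pi fun β => MvPowerSeries.coeff β.toFinsupp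

theorem coefs_apply (f : MvPowerSeries ℕ ℚ) (β : List ℕ) :
    coefs f β = MvPowerSeries.coeff β.toFinsupp f := rfl

theorem coefs_injective : Function.Injective coefs := by
  intro f g h
  ext x
  obtain ⟨l, -, rfl⟩ := exists_toFinsupp x 0
  exact congrFun h l

/-- A function on lists that does not change when a zero is removed. -/
def ZeroInsensitive (c : List ℕ → ℚ) : Prop := ∀ β, c β = c (β.filter (· ≠ 0))

theorem ZeroInsensitive.insert_zero {c : List ℕ → ℚ} (hc : ZeroInsensitive c) (α γ : List ℕ) :
    c (α ++ 0 :: γ) = c (α ++ γ) := by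
  rw [hc (α ++ 0 :: γ), hc (α ++ γ)]
  simp

theorem ZeroInsensitive.cons_zero {c : List ℕ → ℚ} (hc : ZeroInsensitive c) (γ : List ℕ) :
    c (0 :: γ) = c γ := hc.insert_zero [] γ

theorem zeroInsensitive_coefs {f : MvPowerSeries ℕ ℚ} (hf : f ∈ QSym) :
    ZeroInsensitive (coefs f) := by
  intro β
  refine hf.2 _ _ ?_
  rw [exps_toFinsupp_filter, exps_toFinsupp_filter, List.filter_filter]
  simp

theorem ZeroInsensitive.ext {c c' : List ℕ → ℚ} (hc : ZeroInsensitive c)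
    (hc' : ZeroInsensitive c') (h : ∀ β : List ℕ, (∀ b ∈ β, 0 < b) → c β = c' β) : c = c' := by
  funext β
  rw [hc β, hc' β]
  refine h _ fun b hb => ?_
  have := (List.mem_filter.1 hb).2
  simp at this
  omega

/-! ### Coefficients of renamed power series -/

/-- The bound is chosen to cover both renamings used below: merging one adjacent pair of variables,
and halving all indices. -/
theorem tendstoCofinite_of_le (π : ℕ → ℕ) (h : ∀ n, n ≤ 2 * π n + 1) : TendstoCofinite π := by
  rw [tendstoCofinite_iff_finite_preimage_singleton]
  intro b
  refine (Set.finite_Iic (2 * b + 1)).subset ?_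
  rintro n rfl
  exact h n

/-- The sum of the values of `g` on the fibre of `Finsupp.mapDomain π` over `ν`. -/
def fiberSum (π : ℕ → ℕ) [TendstoCofinite π] (g : (ℕ →₀ ℕ) → ℚ) (ν : ℕ →₀ ℕ) : ℚ :=
  ∑ x ∈ (TendstoCofinite.finite_preimage_singleton (Finsupp.mapDomain (M := ℕ) π) ν).toFinset, g x

theorem coeff_rename_eq_fiberSum (π : ℕ → ℕ) [TendstoCofinite π] (f : MvPowerSeries ℕ ℚ)
    (ν : ℕ →₀ ℕ) : MvPowerSeries.coeff ν (MvPowerSeries.rename π f) =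
      fiberSum π (fun x => MvPowerSeries.coeff x f) ν :=
  MvPowerSeries.coeff_rename _ _ _

theorem fiberSum_id [TendstoCofinite (fun n : ℕ => n)] (g : (ℕ →₀ ℕ) → ℚ) (ν : ℕ →₀ ℕ) :
    fiberSum (fun n => n) g ν = g ν := by
  have h : (Finsupp.mapDomain fun n : ℕ => n) = fun x : ℕ →₀ ℕ => x :=
    funext fun x => Finsupp.mapDomain_id
  unfold fiberSum
  rw [sum_eq_single ν]
  · intro b hb hne
    simp [h] at hb
    exact absurd hb hne
  · intro hb
    simp [h] at hb

theorem mapDomain_fcons {π π' : ℕ → ℕ} (h0 : π 0 = 0) (h : ∀ n, π (n + 1) = π' n + 1)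
    (a : ℕ) (x : ℕ →₀ ℕ) : (fcons a x).mapDomain π = fcons a (x.mapDomain π') := by
  rw [fcons, fcons, Finsupp.mapDomain_add, Finsupp.mapDomain_single, h0,
    Finsupp.embDomain_eq_mapDomain, Finsupp.embDomain_eq_mapDomain, ← Finsupp.mapDomain_comp,
    ← Finsupp.mapDomain_comp]
  congr 2
  funext n
  exact h n

theorem mapDomain_fcons_fcons {π π' : ℕ → ℕ} (h0 : π 0 = 0) (h1 : π 1 = 0)
    (h : ∀ n, π (n + 2) = π' n + 1) (a b : ℕ) (x : ℕ →₀ ℕ) :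
    (fcons a (fcons b x)).mapDomain π = fcons (a + b) (x.mapDomain π') := by
  have e : (x.embDomain (addRightEmbedding 1)).embDomain (addRightEmbedding 1) =
      x.mapDomain (· + 2) := by
    rw [Finsupp.embDomain_eq_mapDomain, Finsupp.embDomain_eq_mapDomain, ← Finsupp.mapDomain_comp]
    rfl
  have e' : fcons a (fcons b x) =
      Finsupp.single 0 a + (Finsupp.single 1 b + x.mapDomain (· + 2)) := by
    rw [← e, fcons, fcons]
    congr 1
    rw [Finsupp.embDomain_eq_mapDomain, Finsupp.mapDomain_add, Finsupp.mapDomain_single,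
      ← Finsupp.embDomain_eq_mapDomain]
    rfl
  rw [e', Finsupp.mapDomain_add, Finsupp.mapDomain_add, Finsupp.mapDomain_single,
    Finsupp.mapDomain_single, h0, h1, ← Finsupp.mapDomain_comp, fcons, ← add_assoc,
    ← Finsupp.single_add, Finsupp.embDomain_eq_mapDomain, ← Finsupp.mapDomain_comp]
  congr 2
  funext n
  exact h n

theorem fiberSum_fcons {π π' : ℕ → ℕ} [TendstoCofinite π] [TendstoCofinite π'] (h0 : π 0 = 0)
    (h : ∀ n, π (n + 1) = π' n + 1) (g : (ℕ →₀ ℕ) → ℚ) (a : ℕ) (ν : ℕ →₀ ℕ) :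
    fiberSum π g (fcons a ν) = fiberSum π' (fun x => g (fcons a x)) ν := by
  symm
  unfold fiberSum
  refine sum_bij (fun x _ => fcons a x) ?_ ?_ ?_ ?_
  · intro x hx
    simp only [Set.Finite.mem_toFinset, Set.mem_preimage, Set.mem_singleton_iff] at hx ⊢
    rw [mapDomain_fcons h0 h, hx]
  · intro x _ y _ hxy
    exact (fcons_inj.1 hxy).2
  · intro x hx
    simp only [Set.Finite.mem_toFinset, Set.mem_preimage, Set.mem_singleton_iff] at hx ⊢
    obtain ⟨b, y, rfl⟩ := exists_fcons x
    rw [mapDomain_fcons h0 h, fcons_inj] at hx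
    exact ⟨y, hx.2, by rw [hx.1]⟩
  · intro x _; rfl

/-- If exactly the variables 0 and 1 are merged into 0, an exponent m there can come from any
splitting m = i + j, and the remaining variables are renamed independently. -/
theorem fiberSum_fcons_fcons {π π' : ℕ → ℕ} [TendstoCofinite π] [TendstoCofinite π']
    (h0 : π 0 = 0) (h1 : π 1 = 0) (h : ∀ n, π (n + 2) = π' n + 1) (g : (ℕ →₀ ℕ) → ℚ)
    (m : ℕ) (ν : ℕ →₀ ℕ) :
    fiberSum π g (fcons m ν) =
      ∑ p ∈ antidiagonal m, fiberSum π' (fun x => g (fcons p.1 (fcons p.2 x))) ν := by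
  symm
  unfold fiberSum
  rw [← sum_product']
  refine sum_bij (fun q _ => fcons q.1.1 (fcons q.1.2 q.2)) ?_ ?_ ?_ ?_
  · rintro ⟨⟨i, j⟩, x⟩ hx
    simp only [mem_product, HasAntidiagonal.mem_antidiagonal, Set.Finite.mem_toFinset, Set.mem_preimage,
      Set.mem_singleton_iff] at hx ⊢
    rw [mapDomain_fcons_fcons h0 h1 h, hx.1, hx.2]
  · rintro ⟨⟨i, j⟩, x⟩ _ ⟨⟨i', j'⟩, x'⟩ _ hxy
    simp only [fcons_inj] at hxy
    obtain ⟨rfl, rfl, rfl⟩ := hxy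
    rfl
  · intro x hx
    simp only [Set.Finite.mem_toFinset, Set.mem_preimage, Set.mem_singleton_iff] at hx
    obtain ⟨i, y, rfl⟩ := exists_fcons x
    obtain ⟨j, z, rfl⟩ := exists_fcons y
    rw [mapDomain_fcons_fcons h0 h1 h, fcons_inj] at hx
    exact ⟨((i, j), z), by simpa using hx, rfl⟩
  · intro x _; rfl

/-! ### The Euler relations and multiplication -/

/-- The Euler relations
`∑_{i + j = m} (-1)^j c(…, i, j, …) = 0`, `m > 0`. -/
def Euler (c : List ℕ → ℚ) : Prop :=
  ∀ (α γ : List ℕ) (m : ℕ), 0 < m →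
    ∑ p ∈ antidiagonal m, (-1 : ℚ) ^ p.2 * c (α ++ p.1 :: p.2 :: γ) = 0

/-- The map identifying `p` and `p + 1`. -/
def collapse (p n : ℕ) : ℕ := if n ≤ p then n else n - 1

instance (p : ℕ) : TendstoCofinite (collapse p) :=
  tendstoCofinite_of_le _ fun n => by unfold collapse; split_ifs <;> omega

theorem fiberSum_collapse (α γ : List ℕ) (m : ℕ) (g : (ℕ →₀ ℕ) → ℚ) :
    fiberSum (collapse α.length) g (α ++ m :: γ).toFinsupp =
      ∑ p ∈ antidiagonal m, g (α ++ p.1 :: p.2 :: γ).toFinsupp := by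
  induction α generalizing g with
  | nil =>
    have : TendstoCofinite (fun n : ℕ => n) := TendstoCofinite.id
    simp only [List.nil_append, List.length_nil, toFinsupp_cons]
    rw [fiberSum_fcons_fcons (π' := fun n => n) rfl rfl (fun n => rfl)]
    simp only [fiberSum_id]
  | cons a α ih =>
    simp only [List.cons_append, List.length_cons, toFinsupp_cons]
    rw [fiberSum_fcons (π' := collapse α.length) rfl, ih]
    intro n
    unfold collapse
    split_ifs <;> omega

/-- The substitution `x_{p+1} ↦ -x_p`, `x_n ↦ x_{n-1}` for `n > p + 1`. -/
def cancel (p : ℕ) : MvPowerSeries ℕ ℚ →ₐ[ℚ] MvPowerSeries ℕ ℚ :=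
  (MvPowerSeries.rename (collapse p)).comp
    (MvPowerSeries.rescaleAlgHom fun n => if n = p + 1 then -1 else 1)

theorem prod_sign (q : ℕ) (x : ℕ →₀ ℕ) :
    (x.prod fun s m => (if s = q then (-1 : ℚ) else 1) ^ m) = (-1) ^ x q := by
  rw [Finsupp.prod, prod_eq_single q]
  · simp
  · intro b _ hb; simp [hb]
  · intro h
    simp only [Finsupp.mem_support_iff, not_not] at h
    simp [h]

/-- The left side of an Euler relation is a coefficient of the image of f under an algebra
homomorphism. This is what makes the relations stable under products. -/
theorem coefs_cancel (f : MvPowerSeries ℕ ℚ) (α γ : List ℕ) (m : ℕ) :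
    coefs (cancel α.length f) (α ++ m :: γ) =
      ∑ p ∈ antidiagonal m, (-1 : ℚ) ^ p.2 * coefs f (α ++ p.1 :: p.2 :: γ) := by
  rw [coefs_apply, cancel, AlgHom.comp_apply, coeff_rename_eq_fiberSum, fiberSum_collapse]
  refine sum_congr rfl fun p _ => ?_
  rw [MvPowerSeries.rescaleAlgHom_apply, MvPowerSeries.coeff_rescale, prod_sign, coefs_apply]
  congr 2
  rw [List.toFinsupp_apply, List.getD_append_right _ _ _ _ (by omega)]
  simp

/-- The power series in which the variable `x_p` does not occur. -/
def freeOf (p : ℕ) : Subalgebra ℚ (MvPowerSeries ℕ ℚ) where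
  carrier := {f | ∀ ν : ℕ →₀ ℕ, 0 < ν p → MvPowerSeries.coeff ν f = 0}
  mul_mem' := by
    intro f g hf hg ν hν
    rw [MvPowerSeries.coeff_mul]
    refine sum_eq_zero fun q hq => ?_
    rw [HasAntidiagonal.mem_antidiagonal] at hq
    by_cases h : 0 < q.1 p
    · rw [hf _ h, zero_mul]
    · have : 0 < q.2 p := by
        rw [← hq, Finsupp.add_apply] at hν
        omega
      rw [hg _ this, mul_zero]
  add_mem' := by
    intro f g hf hg ν hν
    rw [map_add, hf ν hν, hg ν hν, add_zero]
  algebraMap_mem' := by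
    intro r ν hν
    rw [MvPowerSeries.algebraMap_apply, MvPowerSeries.coeff_C, if_neg]
    rintro rfl
    simp at hν

theorem euler_coefs_iff (f : MvPowerSeries ℕ ℚ) :
    Euler (coefs f) ↔ ∀ p, cancel p f ∈ freeOf p := by
  constructor
  · intro h p ν hν
    -- Length at least p + 1 ensures that the exponent of x_p is an entry at which the list can be
    -- cut.
    obtain ⟨l, hl, rfl⟩ := exists_toFinsupp ν (p + 1)
    have e : l = l.take p ++ l[p] :: l.drop (p + 1) := by
      rw [← List.drop_eq_getElem_cons (by omega), List.take_append_drop]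
    have hp : (l.take p).length = p := by simp; omega
    have h1 := coefs_cancel f (l.take p) (l.drop (p + 1)) l[p]
    rw [h _ _ _ (by rwa [List.toFinsupp_apply, List.getD_eq_getElem _ _ (show p < l.length by omega)] at hν), hp,
      ← e] at h1
    exact h1
  · intro h α γ m hm
    rw [← coefs_cancel]
    refine h _ _ ?_
    rw [List.toFinsupp_apply, List.getD_append_right _ _ _ _ le_rfl]
    simpa using hm

/-- The algebra of quasisymmetric functions that satisfy the Euler relations. -/
def eulerAlgebra : Subalgebra ℚ (MvPowerSeries ℕ ℚ) :=
  QSym ⊓ ⨅ p, (freeOf p).comap (cancel p)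

theorem mem_eulerAlgebra {f : MvPowerSeries ℕ ℚ} :
    f ∈ eulerAlgebra ↔ f ∈ QSym ∧ Euler (coefs f) := by
  rw [eulerAlgebra, Algebra.mem_inf, euler_coefs_iff, Algebra.mem_iInf]
  rfl

/-! ### Noncommutative symmetric functions acting on functions on lists -/

/-- The action of the complete homogeneous generator of degree `m`. -/
def headOp (m : ℕ) : (List ℕ → ℚ) →ₗ[ℚ] (List ℕ → ℚ) := LinearMap.funLeft ℚ ℚ (m :: ·)

theorem headOp_apply (m : ℕ) (c : List ℕ → ℚ) (X : List ℕ) : headOp m c X = c (m :: X) := rfl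

/-- The action of the elementary generator of degree `m`. -/
def altOp : ℕ → ((List ℕ → ℚ) →ₗ[ℚ] (List ℕ → ℚ))
  | 0 => LinearMap.id
  | m + 1 => ∑ i : Fin (m + 1), (-1 : ℚ) ^ (m - i : ℕ) • (headOp (m + 1 - i) ∘ₗ altOp i)
decreasing_by exact i.2

theorem altOp_zero (c : List ℕ → ℚ) : altOp 0 c = c := by
  rw [altOp]; rfl

/-- This is ∑_{i+j=m+1} (-1)^j e_i h_j = 0 solved for e_{m+1}. -/
theorem altOp_succ (m : ℕ) (c : List ℕ → ℚ) : altOp (m + 1) c =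
    ∑ i ∈ range (m + 1), (-1 : ℚ) ^ (m - i) • headOp (m + 1 - i) (altOp i c) := by
  rw [altOp, LinearMap.sum_apply,
    ← Fin.sum_univ_eq_sum_range (fun i => (-1 : ℚ) ^ (m - i) • headOp (m + 1 - i) (altOp i c))]
  rfl

/-- The action of `∑_{i + j = m} e_i h_j`. -/
def peakOp (m : ℕ) : (List ℕ → ℚ) →ₗ[ℚ] (List ℕ → ℚ) :=
  ∑ p ∈ antidiagonal m, headOp p.2 ∘ₗ altOp p.1

theorem peakOp_apply (m : ℕ) (c : List ℕ → ℚ) :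
    peakOp m c = ∑ p ∈ antidiagonal m, headOp p.2 (altOp p.1 c) := by
  rw [peakOp, LinearMap.sum_apply]; rfl

/-- The pairing with the product of the elements `∑_{i + j = b} e_i h_j` over `b ∈ β`. -/
def peakVal : List ℕ → ((List ℕ → ℚ) →ₗ[ℚ] ℚ)
  | [] => LinearMap.proj []
  | b :: β => peakVal β ∘ₗ peakOp b

theorem peakVal_nil (c : List ℕ → ℚ) : peakVal [] c = c [] := rfl

theorem peakVal_cons (b : ℕ) (β : List ℕ) (c : List ℕ → ℚ) :
    peakVal (b :: β) c = peakVal β (peakOp b c) := rfl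

theorem altOp_eq_zero {m N : ℕ} {c : List ℕ → ℚ} (h : ∀ X : List ℕ, X.sum = m + N → c X = 0) :
    ∀ X : List ℕ, X.sum = N → altOp m c X = 0 := by
  induction m using Nat.strong_induction_on generalizing N with
  | _ m ih =>
    intro X hX
    cases m with
    | zero => rw [altOp_zero]; exact h X (by omega)
    | succ m =>
      rw [altOp_succ, Finset.sum_apply]
      refine sum_eq_zero fun i hi => ?_
      rw [mem_range] at hi
      rw [Pi.smul_apply, headOp_apply, ih i hi (N := m + 1 - i + N), smul_zero]
      · intro Y hY; exact h Y (by omega)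
      · rw [List.sum_cons, hX]

theorem peakOp_eq_zero {m N : ℕ} {c : List ℕ → ℚ} (h : ∀ X : List ℕ, X.sum = m + N → c X = 0) :
    ∀ X : List ℕ, X.sum = N → peakOp m c X = 0 := by
  intro X hX
  rw [peakOp_apply, Finset.sum_apply]
  refine sum_eq_zero fun p hp => ?_
  rw [HasAntidiagonal.mem_antidiagonal] at hp
  rw [headOp_apply]
  refine altOp_eq_zero (N := p.2 + N) (fun Y hY => h Y (by omega)) _ ?_
  rw [List.sum_cons, hX]

/-- `peakVal β` is homogeneous: it only sees lists of the same sum as β. Formulas for coefficients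
that hold in a single degree can therefore be inserted into it. -/
theorem peakVal_eq_zero (β : List ℕ) : ∀ {c : List ℕ → ℚ},
    (∀ X : List ℕ, X.sum = β.sum → c X = 0) → peakVal β c = 0 := by
  induction β with
  | nil => intro c h; exact h [] rfl
  | cons b β ih =>
    intro c h
    rw [peakVal_cons]
    exact ih (peakOp_eq_zero (by simpa using h))

/-! ### Pairing with descent classes -/

/-- Whether `S` contains no integer strictly between `a` and `b`. -/
def noneInd (S : Finset ℕ) (a b : ℕ) : ℚ := if ∀ t ∈ Ioo a b, t ∉ S then 1 else 0

/-- Whether `S` contains all integers strictly between `a` and `b`. -/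
def allInd (S : Finset ℕ) (a b : ℕ) : ℚ := if ∀ t ∈ Ioo a b, t ∈ S then 1 else 0

theorem noneInd_eq_one {S : Finset ℕ} {a b : ℕ} (h : b ≤ a + 1) : noneInd S a b = 1 := by
  refine if_pos fun t ht => ?_
  rw [mem_Ioo] at ht
  omega

theorem allInd_eq_one {S : Finset ℕ} {a b : ℕ} (h : b ≤ a + 1) : allInd S a b = 1 := by
  refine if_pos fun t ht => ?_
  rw [mem_Ioo] at ht
  omega

theorem noneInd_succ {S : Finset ℕ} {a b : ℕ} (h : a < b) :
    noneInd S a (b + 1) = if b ∈ S then 0 else noneInd S a b := by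
  unfold noneInd
  by_cases hb : b ∈ S
  · rw [if_pos hb, if_neg]
    intro h'
    exact h' b (by rw [mem_Ioo]; omega) hb
  · rw [if_neg hb]
    congr 1
    simp only [mem_Ioo, eq_iff_iff]
    constructor
    · intro h' t ht
      exact h' t (by omega)
    · intro h' t ht hS
      by_cases htb : t = b
      · exact hb (htb ▸ hS)
      · exact h' t (by omega) hS

theorem allInd_succ {S : Finset ℕ} {a b : ℕ} (h : a < b) :
    allInd S a (b + 1) = if b ∈ S then allInd S a b else 0 := by
  unfold allInd
  by_cases hb : b ∈ S
  · rw [if_pos hb]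
    congr 1
    simp only [mem_Ioo, eq_iff_iff]
    constructor
    · intro h' t ht
      exact h' t (by omega)
    · intro h' t ht
      by_cases htb : t = b
      · exact htb ▸ hb
      · exact h' t (by omega)
  · rw [if_neg hb, if_neg]
    intro h'
    exact hb (h' b (by rw [mem_Ioo]; omega))

/-- `Lam S` collects the starting points of the runs of S, other than 1. Walking down from b ∈ S,
the absence of a starting point above a + 1 keeps the walk inside S until a + 1. -/
theorem noneInd_lam_succ_of_mem {S : Finset ℕ} {a b : ℕ} (h : a < b) (hb : b ∈ S) :
    noneInd (Lam S) (a + 1) (b + 1) = allInd S a b := by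
  unfold noneInd allInd
  congr 1
  simp only [mem_Ioo, eq_iff_iff, Lam, mem_filter]
  constructor
  · intro h'
    have key : ∀ k, a < b - k → b - k ∈ S := by
      intro k
      induction k with
      | zero => intro _; exact hb
      | succ k ih =>
        intro hk
        have h1 := ih (by omega)
        by_contra h2
        refine h' (b - k) (by omega) ⟨h1, by omega, ?_⟩
        rwa [show b - k - 1 = b - (k + 1) by omega]
    intro t ht
    have := key (b - t) (by omega)
    rwa [show b - (b - t) = t by omega] at this
  · intro h' t ht hS
    exact hS.2.2 (h' (t - 1) (by omega))

/-- One recursion on the last interior point serves both signs. If that point lies in S, only the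
last two cuts survive; if not, it can be dropped from the interval. -/
theorem sum_all_none (S : Finset ℕ) (ε : ℚ) (a m : ℕ) :
    ∑ i ∈ range (m + 1 + 2), ε ^ i * (allInd S a (a + i) * noneInd S (a + i) (a + (m + 2))) =
      if a + (m + 1) ∈ S then (1 + ε) * ε ^ (m + 1) * allInd S a (a + (m + 1)) else
      ∑ i ∈ range (m + 2), ε ^ i * (allInd S a (a + i) * noneInd S (a + i) (a + (m + 1))) := by
  rw [sum_range_succ, sum_range_succ, sum_range_succ (n := m + 1), noneInd_eq_one (by omega),
    noneInd_eq_one (by omega), noneInd_eq_one (by omega)]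
  have e : ∀ i ∈ range (m + 1),
      ε ^ i * (allInd S a (a + i) * noneInd S (a + i) (a + (m + 2))) =
      if a + (m + 1) ∈ S then 0 else
        ε ^ i * (allInd S a (a + i) * noneInd S (a + i) (a + (m + 1))) := by
    intro i hi
    rw [mem_range] at hi
    rw [show a + (m + 2) = a + (m + 1) + 1 by omega, noneInd_succ (by omega)]
    split_ifs <;> simp
  rw [sum_congr rfl e, show a + (m + 1 + 1) = a + (m + 1) + 1 by omega, allInd_succ (by omega)]
  split_ifs
  · simp only [sum_const_zero]; ring
  · ring

/-- A cut i contributes only if S meets the open interval in an initial segment {a+1, …, a+k}, and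
then exactly i = k and i = k + 1 contribute, because membership of the cut point itself is not
tested. With alternating signs these two cancel. -/
theorem sum_all_none_neg (S : Finset ℕ) (a m : ℕ) :
    ∑ i ∈ range (m + 2),
      (-1 : ℚ) ^ i * (allInd S a (a + i) * noneInd S (a + i) (a + (m + 1))) = 0 := by
  induction m with
  | zero =>
    rw [sum_range_succ, sum_range_succ, sum_range_zero, noneInd_eq_one (by omega),
      noneInd_eq_one (by omega), allInd_eq_one (by omega), allInd_eq_one (by omega)]
    norm_num
  | succ m ih =>
    rw [show m + 1 + 1 = m + 2 by rfl, sum_all_none, ih]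
    simp

/-- The same two cuts now add up to 2, and S meets the interval in an initial segment exactly when
no run of S starts at an interior point beyond a + 1. -/
theorem sum_all_none_pos (S : Finset ℕ) (a m : ℕ) :
    ∑ i ∈ range (m + 2), allInd S a (a + i) * noneInd S (a + i) (a + (m + 1)) =
      2 * noneInd (Lam S) (a + 1) (a + (m + 1)) := by
  induction m with
  | zero =>
    rw [sum_range_succ, sum_range_succ, sum_range_zero, noneInd_eq_one (by omega),
      noneInd_eq_one (by omega), noneInd_eq_one (by omega), allInd_eq_one (by omega),
      allInd_eq_one (by omega)]
    norm_num
  | succ m ih =>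
    have h := sum_all_none S 1 a m
    simp only [one_pow, one_mul, mul_one] at h
    rw [show m + 1 + 1 = m + 2 by rfl, h, ih]
    by_cases hS : a + (m + 1) ∈ S
    · rw [if_pos hS, show a + (m + 2) = a + (m + 1) + 1 by omega,
        noneInd_lam_succ_of_mem (by omega) hS]
      norm_num
    · rw [if_neg hS]
      -- For m = 0 the new point is a + 1, which the right side disregards.
      by_cases hm : m = 0
      · subst hm
        rw [noneInd_eq_one (by omega), noneInd_eq_one (by omega)]
      · rw [show a + (m + 2) = a + (m + 1) + 1 by omega, noneInd_succ (by omega), if_neg]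
        exact fun h => hS (mem_filter.1 h).1

/-- Whether `S` contains no integer strictly inside one of the consecutive intervals of lengths
`β`, starting at `a`. -/
def ascInd (S : Finset ℕ) : ℕ → List ℕ → ℚ
  | _, [] => 1
  | a, m :: X => noneInd S a (a + m) * ascInd S (a + m) X

/-- As `ascInd`, but the first interior integer of each interval is disregarded. -/
def pkInd (S : Finset ℕ) : ℕ → List ℕ → ℚ
  | _, [] => 1
  | a, m :: X => noneInd S (a + 1) (a + m) * pkInd S (a + m) X

theorem headOp_ascInd (S : Finset ℕ) (a m : ℕ) :
    headOp m (ascInd S a) = noneInd S a (a + m) • ascInd S (a + m) := rfl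

/-- The recursion defining e_m determines it from the h_j, and `sum_all_none_neg` says that `allInd`
solves this recursion when h_j acts through `noneInd`. -/
theorem altOp_ascInd (S : Finset ℕ) (a m : ℕ) :
    altOp m (ascInd S a) = allInd S a (a + m) • ascInd S (a + m) := by
  induction m using Nat.strong_induction_on with
  | _ m ih =>
    cases m with
    | zero => rw [altOp_zero, allInd_eq_one (by omega), one_smul]; rfl
    | succ m =>
      have e : ∀ i ∈ range (m + 1),
          (-1 : ℚ) ^ (m - i) • headOp (m + 1 - i) (altOp i (ascInd S a)) =
          ((-1 : ℚ) ^ m * ((-1) ^ i *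
            (allInd S a (a + i) * noneInd S (a + i) (a + (m + 1))))) •
            ascInd S (a + (m + 1)) := by
        intro i hi
        have hi' := mem_range.1 hi
        rw [ih i hi', map_smul, headOp_ascInd, show a + i + (m + 1 - i) = a + (m + 1) by omega,
          smul_smul, smul_smul]
        congr 1
        have h1 : (-1 : ℚ) ^ m = (-1) ^ (m - i) * (-1) ^ i := by
          rw [← pow_add]; congr 1; omega
        have h2 : (-1 : ℚ) ^ i * (-1) ^ i = 1 := by rw [← mul_pow]; simp
        rw [h1]
        linear_combination (-(-1 : ℚ) ^ (m - i) * allInd S a (a + i) *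
          noneInd S (a + i) (a + (m + 1))) * h2
      have h := sum_all_none_neg S a m
      rw [sum_range_succ, noneInd_eq_one (by omega)] at h
      rw [altOp_succ, sum_congr rfl e, ← sum_smul, ← mul_sum]
      congr 1
      have h1 : (-1 : ℚ) ^ m * (-1) ^ m = 1 := by rw [← mul_pow]; simp
      rw [pow_succ] at h
      linear_combination (-1 : ℚ) ^ m * h + allInd S a (a + (m + 1)) * h1

theorem peakOp_ascInd (S : Finset ℕ) (a m : ℕ) (hm : 0 < m) :
    peakOp m (ascInd S a) = (2 * noneInd (Lam S) (a + 1) (a + m)) • ascInd S (a + m) := by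
  obtain ⟨m, rfl⟩ : ∃ k, m = k + 1 := ⟨m - 1, by omega⟩
  rw [peakOp_apply, Nat.sum_antidiagonal_eq_sum_range_succ_mk, ← sum_all_none_pos, sum_smul]
  refine sum_congr rfl fun i hi => ?_
  rw [mem_range] at hi
  simp only
  rw [altOp_ascInd, map_smul, headOp_ascInd, show a + i + (m + 1 - i) = a + (m + 1) by omega,
    smul_smul]

theorem peakVal_ascInd (S : Finset ℕ) (β : List ℕ) : ∀ a, (∀ b ∈ β, 0 < b) →
    peakVal β (ascInd S a) = 2 ^ β.length * pkInd (Lam S) a β := by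
  induction β with
  | nil => intro a _; simp [peakVal_nil, ascInd, pkInd]
  | cons b β ih =>
    intro a h
    rw [peakVal_cons, peakOp_ascInd _ _ _ (h b (by simp)), map_smul,
      ih _ (fun x hx => h x (by simp [hx])), pkInd, List.length_cons, smul_eq_mul]
    ring

/-! ### Interval indicators as covering conditions on the cut points -/

theorem noneInd_mul_ite {S : Finset ℕ} {a b : ℕ} {p : Prop} [Decidable p] :
    noneInd S a b * (if p then 1 else 0) = if (∀ t ∈ Ioo a b, t ∉ S) ∧ p then 1 else 0 := by
  unfold noneInd
  rw [ite_mul, one_mul, zero_mul]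
  split_ifs with h1 h2 h3 h4 <;> first | rfl | tauto

/-- The list l consists of the interior cut points. When l enumerates T ⊆ [N - 1] and a = 0, the
condition is S ⊆ T for S ⊆ [N - 1], as in the definition of F_S. -/
theorem ascInd_gaps (S : Finset ℕ) (N : ℕ) (l : List ℕ) : ∀ a,
    (a :: (l ++ [N])).Pairwise (· < ·) →
    ascInd S a (gaps a (l ++ [N])) = if ∀ s ∈ S, a < s → s < N → s ∈ l then 1 else 0 := by
  induction l with
  | nil =>
    intro a h
    have h1 : a < N := by simpa using h
    simp only [List.nil_append, gaps, ascInd, mul_one, noneInd]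
    congr 1
    simp only [mem_Ioo, eq_iff_iff, List.not_mem_nil]
    rw [show a + (N - a) = N by omega]
    exact ⟨fun h s hs h1 h2 => h s ⟨h1, h2⟩ hs, fun h s hs h' => h s h' hs.1 hs.2⟩
  | cons b l ih =>
    intro a h
    have h' := List.pairwise_cons.1 h
    have h1 := h'.1 b (by simp)
    have h2 := (List.pairwise_cons.1 h'.2).1
    have h3 := h2 N (by simp)
    rw [List.cons_append, gaps, ascInd, show a + (b - a) = b by omega, ih b h'.2, noneInd_mul_ite]
    congr 1
    simp only [mem_Ioo, eq_iff_iff, List.mem_cons]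
    constructor
    · rintro ⟨g1, g2⟩ s hs hs1 hs2
      rcases lt_trichotomy s b with hb | hb | hb
      · exact absurd hs (g1 s ⟨hs1, hb⟩)
      · exact Or.inl hb
      · exact Or.inr (g2 s hs hb hs2)
    · intro g
      refine ⟨fun t ht hS => ?_, fun s hs hs1 hs2 => ?_⟩
      · rcases g t hS ht.1 (by omega) with hb | hb
        · omega
        · have := h2 t (by simp [hb]); omega
      · rcases g s hs (by omega) hs2 with hb | hb
        · omega
        · exact hb

/-- The disregarded integer after a cut point b is b + 1; this is the source of T + 1 in the
condition S ⊆ T ∪ (T + 1). -/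
theorem pkInd_gaps (S : Finset ℕ) (N : ℕ) (l : List ℕ) : ∀ a,
    (a :: (l ++ [N])).Pairwise (· < ·) →
    pkInd S a (gaps a (l ++ [N])) =
      if ∀ s ∈ S, a + 1 < s → s < N → s ∈ l ∨ s - 1 ∈ l then 1 else 0 := by
  induction l with
  | nil =>
    intro a h
    have h1 : a < N := by simpa using h
    simp only [List.nil_append, gaps, pkInd, mul_one, noneInd]
    congr 1
    simp only [mem_Ioo, eq_iff_iff, List.not_mem_nil, or_false]
    rw [show a + (N - a) = N by omega]
    exact ⟨fun h s hs h1 h2 => h s ⟨h1, h2⟩ hs, fun h s hs h' => h s h' hs.1 hs.2⟩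
  | cons b l ih =>
    intro a h
    have h' := List.pairwise_cons.1 h
    have h1 := h'.1 b (by simp)
    have h2 := (List.pairwise_cons.1 h'.2).1
    have h3 := h2 N (by simp)
    rw [List.cons_append, gaps, pkInd, show a + (b - a) = b by omega, ih b h'.2, noneInd_mul_ite]
    congr 1
    simp only [mem_Ioo, eq_iff_iff, List.mem_cons]
    constructor
    · rintro ⟨g1, g2⟩ s hs hs1 hs2
      by_cases c1 : s < b
      · exact absurd hs (g1 s ⟨hs1, c1⟩)
      -- Here s = b or s = b + 1, so s is covered by the cut point b.
      by_cases c2 : s ≤ b + 1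
      · omega
      · rcases g2 s hs (by omega) hs2 with hb | hb
        · exact Or.inl (Or.inr hb)
        · exact Or.inr (Or.inr hb)
    · intro g
      refine ⟨fun t ht hS => ?_, fun s hs hs1 hs2 => ?_⟩
      · rcases g t hS ht.1 (by omega) with (hb | hb) | (hb | hb)
        · omega
        · have := h2 t (by simp [hb]); omega
        · omega
        · have := h2 (t - 1) (by simp [hb]); omega
      · rcases g s hs (by omega) hs2 with (hb | hb) | (hb | hb)
        · omega
        · exact Or.inl hb
        · omega
        · exact Or.inr hb

theorem noneInd_self (S : Finset ℕ) (a : ℕ) : noneInd S a a = 1 := noneInd_eq_one (by omega)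

theorem ascInd_filter (S : Finset ℕ) (β : List ℕ) : ∀ a,
    ascInd S a (β.filter (· ≠ 0)) = ascInd S a β := by
  induction β with
  | nil => intro a; rfl
  | cons b β ih =>
    intro a
    by_cases hb : b = 0
    · subst hb
      rw [ascInd, add_zero, noneInd_self, one_mul, ← ih a]
      simp
    · rw [List.filter_cons_of_pos (by simpa using hb), ascInd, ascInd, ih]

theorem sum_filter_ne_zero (β : List ℕ) : (β.filter (· ≠ 0)).sum = β.sum := by
  induction β with
  | nil => rfl
  | cons b β ih =>
    by_cases hb : b = 0
    · subst hb
      rw [List.sum_cons, zero_add, ← ih]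
      simp
    · rw [List.filter_cons_of_pos (by simpa using hb), List.sum_cons, List.sum_cons, ih]

/-! ### Coefficients of the standard quasisymmetric functions -/

theorem coefs_M (n : ℕ) (T : Finset ℕ) (β : List ℕ) :
    coefs (M n T) β = if β.filter (· ≠ 0) = comp n T then 1 else 0 := by
  rw [← exps_toFinsupp_filter]
  exact coeff_monoSeries _ _

theorem coefs_one (β : List ℕ) : coefs 1 β = if β.filter (· ≠ 0) = [] then 1 else 0 := by
  rw [← exps_toFinsupp_filter]
  exact coeff_MFamily none β.toFinsupp

theorem comp_injective {n : ℕ} {S T : Finset ℕ} (hS : S ⊆ Icc 1 n) (hT : T ⊆ Icc 1 n) :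
    comp n S = comp n T ↔ S = T := by
  refine ⟨fun h => ?_, fun h => h ▸ rfl⟩
  have := @listOf_injective (some ⟨n, S, hS⟩) (some ⟨n, T, hT⟩) h
  simpa using this

theorem comp_pos {n : ℕ} {S : Finset ℕ} (hS : S ⊆ Icc 1 n) : ∀ b ∈ comp n S, 0 < b :=
  listOf_pos (some ⟨n, S, hS⟩)

theorem filter_comp {n : ℕ} {S : Finset ℕ} (hS : S ⊆ Icc 1 n) :
    (comp n S).filter (· ≠ 0) = comp n S := by
  rw [List.filter_eq_self]
  intro b hb
  have := comp_pos hS b hb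
  simp; omega

theorem exists_comp {β : List ℕ} {n : ℕ} (hβ : ∀ b ∈ β, 0 < b) (hs : β.sum = n + 1) :
    ∃ T ⊆ Icc 1 n, β = comp n T := by
  obtain ⟨i, hi⟩ := listOf_surj β hβ
  rcases i with _ | ⟨k, T, hT⟩
  · rw [← hi] at hs; simp [listOf] at hs
  · have h1 : listOf (some ⟨k, T, hT⟩) = comp k T := rfl
    rw [h1] at hi
    rw [← hi, comp_sum hT] at hs
    obtain rfl : k = n := by omega
    exact ⟨T, hT, hi.symm⟩

theorem length_gaps (l : List ℕ) : ∀ a, (gaps a l).length = l.length := by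
  induction l with
  | nil => intro a; rfl
  | cons b l ih => intro a; simp [gaps, ih]

theorem length_comp (n : ℕ) (T : Finset ℕ) : (comp n T).length = T.card + 1 := by
  simp [comp, length_gaps]

theorem coefs_M_comp {n : ℕ} {S T : Finset ℕ} (hS : S ⊆ Icc 1 n) (hT : T ⊆ Icc 1 n) :
    coefs (M n T) (comp n S) = if S = T then 1 else 0 := by
  rw [coefs_M, filter_comp hS]
  simp only [comp_injective hS hT]

theorem coefs_M_of_sum_ne {n : ℕ} {T : Finset ℕ} (hT : T ⊆ Icc 1 n) {β : List ℕ}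
    (h : β.sum ≠ n + 1) : coefs (M n T) β = 0 := by
  rw [coefs_M, if_neg]
  intro h'
  apply h
  rw [← sum_filter_ne_zero, h', comp_sum hT]

theorem coefs_sum_coe {ι : Type*} (s : Finset ι) (g : ι → QSym) (β : List ℕ) :
    coefs ((∑ i ∈ s, g i : QSym) : MvPowerSeries ℕ ℚ) β = ∑ i ∈ s, coefs (g i) β := by
  rw [AddSubmonoidClass.coe_finsetSum, map_sum, Finset.sum_apply]

theorem coefs_F_comp {n : ℕ} {S T : Finset ℕ} (hT : T ⊆ Icc 1 n) :
    coefs (F n S) (comp n T) = if S ⊆ T then 1 else 0 := by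
  rw [F, coefs_sum_coe, sum_filter]
  have e : ∀ U ∈ (Icc 1 n).powerset, (if S ⊆ U then coefs (M n U) (comp n T) else 0) =
      if T = U then (if S ⊆ T then 1 else 0) else 0 := by
    intro U hU
    rw [coefs_M_comp hT (mem_powerset.1 hU)]
    by_cases h : T = U
    · subst h; simp
    · simp [h]
  rw [sum_congr rfl e, sum_ite_eq, if_pos (mem_powerset.2 hT)]

theorem coefs_F_of_sum_ne {n : ℕ} {S : Finset ℕ} {β : List ℕ} (h : β.sum ≠ n + 1) :
    coefs (F n S) β = 0 := by
  rw [F, coefs_sum_coe]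
  exact sum_eq_zero fun U hU => coefs_M_of_sum_ne (mem_powerset.1 (mem_filter.1 hU).1) h

theorem coefs_Theta_comp {n : ℕ} {S T : Finset ℕ} (hT : T ⊆ Icc 1 n) :
    coefs (Theta n S) (comp n T) =
      if S ⊆ T ∪ T.image (· + 1) then 2 ^ (T.card + 1) else 0 := by
  rw [Theta, coefs_sum_coe, sum_filter]
  have e : ∀ U ∈ (Icc 1 n).powerset, (if S ⊆ U ∪ U.image (· + 1) then
      coefs ((2 : ℚ) ^ (U.card + 1) • M n U : QSym) (comp n T) else 0) =
      if T = U then (if S ⊆ T ∪ T.image (· + 1) then 2 ^ (T.card + 1) else 0) else 0 := by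
    intro U hU
    have : coefs ((2 : ℚ) ^ (U.card + 1) • M n U : QSym) (comp n T) =
      2 ^ (U.card + 1) * coefs (M n U) (comp n T) := rfl
    rw [this, coefs_M_comp hT (mem_powerset.1 hU)]
    by_cases h : T = U
    · subst h; simp
    · simp [h]
  rw [sum_congr rfl e, sum_ite_eq, if_pos (mem_powerset.2 hT)]

theorem coefs_Theta_of_sum_ne {n : ℕ} {S : Finset ℕ} {β : List ℕ} (h : β.sum ≠ n + 1) :
    coefs (Theta n S) β = 0 := by
  rw [Theta, coefs_sum_coe]
  refine sum_eq_zero fun U hU => ?_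
  have : coefs ((2 : ℚ) ^ (U.card + 1) • M n U : QSym) β =
      2 ^ (U.card + 1) * coefs (M n U) β := rfl
  rw [this, coefs_M_of_sum_ne (mem_powerset.1 (mem_filter.1 hU).1) h, mul_zero]

theorem coefs_F_eq_ascInd {n : ℕ} {S : Finset ℕ} (hS : S ⊆ Icc 1 n) {β : List ℕ}
    (h : β.sum = n + 1) : coefs (F n S) β = ascInd S 0 β := by
  rw [zeroInsensitive_coefs (F n S).2, ← ascInd_filter]
  obtain ⟨T, hT, e⟩ := exists_comp (β := β.filter (· ≠ 0)) (n := n)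
    (fun b hb => by have := (List.mem_filter.1 hb).2; simp at this; omega)
    (by rw [sum_filter_ne_zero, h])
  rw [e, coefs_F_comp hT, comp, ascInd_gaps _ _ _ _ (pairwise_sort_append hT)]
  congr 1
  simp only [mem_sort, eq_iff_iff]
  constructor
  · intro h s hs _ _; exact h hs
  · intro h s hs
    have := mem_Icc.1 (hS hs)
    exact h s hs (by omega) (by omega)

theorem coefs_Theta_eq_pkInd {n : ℕ} {S : Finset ℕ} (hS : S ⊆ Icc 1 n) (h1 : 1 ∉ S)
    {β : List ℕ} (hβ : ∀ b ∈ β, 0 < b) (h : β.sum = n + 1) :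
    coefs (Theta n S) β = 2 ^ β.length * pkInd S 0 β := by
  obtain ⟨T, hT, rfl⟩ := exists_comp hβ h
  rw [coefs_Theta_comp hT, length_comp, comp, pkInd_gaps _ _ _ _ (pairwise_sort_append hT),
    mul_ite, mul_one, mul_zero]
  congr 1
  simp only [mem_sort, eq_iff_iff]
  constructor
  · intro h s hs h1 h2
    have := h hs
    rw [mem_union, mem_image] at this
    rcases this with h3 | ⟨t, ht, rfl⟩
    · exact Or.inl h3
    · exact Or.inr (by simpa using ht)
  · intro h s hs
    have h2 := mem_Icc.1 (hS hs)
    have h3 : s ≠ 1 := fun h' => h1 (h' ▸ hs)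
    rw [mem_union, mem_image]
    rcases h s hs (by omega) (by omega) with h4 | h4
    · exact Or.inl h4
    · exact Or.inr ⟨s - 1, h4, by omega⟩

/-! ### The Stembridge map in the monomial basis -/

/-- Checked on the basis of the F_S, where e_i h_j can be evaluated through `ascInd`: each part of β
contributes a factor 2 and replaces S by `Lam S`, which gives the coefficient of Θ_{Λ(S)}. -/
theorem coefs_stembridge (f : QSym) {β : List ℕ} (hβ : ∀ b ∈ β, 0 < b) :
    coefs (stembridge f) β = peakVal β (coefs f) := by
  have key : (LinearMap.proj β ∘ₗ coefs) ∘ₗ Peak.val.toLinearMap ∘ₗ stembridge =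
      (peakVal β ∘ₗ coefs) ∘ₗ QSym.val.toLinearMap := by
    apply basisF.ext
    rintro (_ | ⟨n, S, hS⟩)
    · rw [basisF_none]
      change coefs (stembridge 1) β = peakVal β (coefs 1)
      rw [stembridge_one]
      change coefs 1 β = peakVal β (coefs 1)
      cases β with
      | nil => rfl
      | cons b β =>
        have hb := hβ b (by simp)
        rw [peakVal_eq_zero, coefs_one, if_neg]
        · intro h
          rw [List.filter_eq_nil_iff] at h
          exact h b (by simp) (by simpa using hb.ne')
        · intro X hX
          rw [coefs_one, if_neg]
          intro h
          rw [← sum_filter_ne_zero, h, List.sum_cons] at hX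
          simp at hX
          omega
    · rw [basisF_some]
      change coefs (stembridge (F n S)) β = peakVal β (coefs (F n S))
      rw [stembridge_F n S hS]
      have hL : Lam S ⊆ Icc 1 n := (filter_subset _ _).trans hS
      have hL1 : 1 ∉ Lam S := fun h => (mem_filter.1 h).2.1 rfl
      by_cases h : β.sum = n + 1
      -- The coefficients of F_S agree with `ascInd S 0` only in degree n + 1, so the two functions
      -- are compared under `peakVal β` by homogeneity.
      · rw [coefs_Theta_eq_pkInd hL hL1 hβ h, ← peakVal_ascInd _ _ _ hβ, ← sub_eq_zero,
          ← map_sub]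
        refine peakVal_eq_zero β fun X hX => ?_
        rw [Pi.sub_apply, coefs_F_eq_ascInd hS (hX.trans h), sub_self]
      · rw [coefs_Theta_of_sum_ne h, peakVal_eq_zero]
        intro X hX
        exact coefs_F_of_sum_ne (hX ▸ h)
  exact LinearMap.congr_fun key f

/-! ### The duplication of variables -/

/-- `∑ c(i_1, j_1, i_2, j_2, …)` over all `i_k + j_k = β_k`. -/
def dbl : List ℕ → (List ℕ → ℚ) → ℚ
  | [], c => c []
  | b :: β, c => ∑ p ∈ antidiagonal b, dbl β (fun X => c (p.1 :: p.2 :: X))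

theorem Euler.tail {c : List ℕ → ℚ} (h : Euler c) (m : ℕ) : Euler (headOp m c) :=
  fun α γ k hk => h (m :: α) γ k hk

theorem ZeroInsensitive.tail {c : List ℕ → ℚ} (h : ZeroInsensitive c) (m : ℕ) :
    ZeroInsensitive (headOp m c) := by
  intro β
  rw [headOp_apply, headOp_apply, h, h (m :: _)]
  simp [List.filter_cons]

/-- By induction e_i may be replaced by h_i for smaller i. The recursion for the next one is then
the Euler relation at the front of the list, solved for its term with j = 0. -/
theorem altOp_of_euler {c : List ℕ → ℚ} (h : Euler c) (hz : ZeroInsensitive c) (m : ℕ) :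
    altOp m c = headOp m c := by
  induction m using Nat.strong_induction_on with
  | _ m ih =>
    funext X
    cases m with
    | zero => rw [altOp_zero, headOp_apply, hz.cons_zero]
    | succ m =>
      rw [altOp_succ, Finset.sum_apply]
      have e : ∀ i ∈ range (m + 1),
          ((-1 : ℚ) ^ (m - i) • headOp (m + 1 - i) (altOp i c)) X =
          -((-1) ^ (m + 1 - i) * c (i :: (m + 1 - i) :: X)) := by
        intro i hi
        have hi' := mem_range.1 hi
        rw [ih i hi', Pi.smul_apply, headOp_apply, headOp_apply, smul_eq_mul,
          show m + 1 - i = (m - i) + 1 by omega, pow_succ]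
        ring
      have h1 := h [] X (m + 1) (by omega)
      rw [Nat.sum_antidiagonal_eq_sum_range_succ_mk, sum_range_succ] at h1
      simp only [List.nil_append, Nat.sub_self, pow_zero, one_mul] at h1
      have h2 := (hz.tail (m + 1)).cons_zero X
      rw [headOp_apply, headOp_apply] at h2
      rw [sum_congr rfl e, sum_neg_distrib, headOp_apply, ← h2]
      linarith

theorem peakVal_of_euler (β : List ℕ) : ∀ {c : List ℕ → ℚ}, Euler c → ZeroInsensitive c →
    peakVal β c = dbl β c := by
  induction β with
  | nil => intro c _ _; rfl
  | cons b β ih =>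
    intro c h hz
    rw [peakVal_cons, peakOp_apply, map_sum, dbl]
    refine sum_congr rfl fun p _ => ?_
    rw [altOp_of_euler h hz, ih ((h.tail _).tail _) ((hz.tail _).tail _)]
    rfl

theorem dbl_filter (β : List ℕ) : ∀ {c : List ℕ → ℚ}, ZeroInsensitive c →
    dbl (β.filter (· ≠ 0)) c = dbl β c := by
  induction β with
  | nil => intro c _; rfl
  | cons b β ih =>
    intro c hz
    by_cases hb : b = 0
    · subst hb
      have h0 : (fun X => c (0 :: 0 :: X)) = c :=
        funext fun X => by rw [hz.cons_zero, hz.cons_zero]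
      rw [List.filter_cons_of_neg (by simp), ih hz, dbl, Nat.antidiagonal_zero, sum_singleton, h0]
    · rw [List.filter_cons_of_pos (by simpa using hb), dbl, dbl]
      exact sum_congr rfl fun p _ => ih ((hz.tail p.1).tail p.2)

instance : TendstoCofinite (fun n : ℕ => n / 2) := tendstoCofinite_of_le _ fun n => by omega

/-- The substitution `x_{2n}, x_{2n+1} ↦ x_n`. -/
def duplicate : MvPowerSeries ℕ ℚ →ₐ[ℚ] MvPowerSeries ℕ ℚ :=
  MvPowerSeries.rename fun n => n / 2

theorem fiberSum_half (β : List ℕ) (g : (ℕ →₀ ℕ) → ℚ) :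
    fiberSum (fun n => n / 2) g β.toFinsupp = dbl β (fun X => g X.toFinsupp) := by
  induction β generalizing g with
  | nil =>
    rw [dbl, List.toFinsupp_nil, fiberSum, sum_eq_single 0]
    · intro x hx hne
      simp only [Set.Finite.mem_toFinset, Set.mem_preimage, Set.mem_singleton_iff] at hx
      -- Renaming preserves the total degree, so the fibre over 0 is {0}.
      have h := Finsupp.degree_mapDomain (fun n => n / 2) x
      rw [hx, map_zero, eq_comm, Finsupp.degree_eq_zero_iff] at h
      exact absurd h hne
    · intro h
      simp at h
  | cons b β ih =>
    rw [toFinsupp_cons, fiberSum_fcons_fcons (π' := fun n => n / 2) rfl rfl (fun n => by omega),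
      dbl]
    refine sum_congr rfl fun p _ => ?_
    rw [ih]
    simp only [toFinsupp_cons]

theorem coefs_duplicate (f : MvPowerSeries ℕ ℚ) (β : List ℕ) :
    coefs (duplicate f) β = dbl β (coefs f) := by
  rw [coefs_apply, duplicate, coeff_rename_eq_fiberSum, fiberSum_half]
  rfl

/-- On the Euler algebra, the Stembridge map duplicates the variables. -/
theorem stembridge_eq_duplicate (f : QSym) (h : Euler (coefs f)) :
    (stembridge f : MvPowerSeries ℕ ℚ) = duplicate f := by
  apply coefs_injective
  funext β
  have hz := zeroInsensitive_coefs f.2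
  rw [zeroInsensitive_coefs (peak_le_qsym (stembridge f).2), coefs_stembridge,
    peakVal_of_euler _ h hz, dbl_filter _ hz, coefs_duplicate]
  intro b hb
  have := (List.mem_filter.1 hb).2
  simp at this
  omega

/-! ### The Euler relations for the functions `Θ_S` -/

/-- Zero-insensitive extension of `2 ^ length * pkInd`. -/
def thetaVal (S : Finset ℕ) : ℕ → List ℕ → ℚ
  | _, [] => 1
  | a, m :: X => (if m = 0 then 1 else 2 * noneInd S (a + 1) (a + m)) * thetaVal S (a + m) X

theorem thetaVal_of_pos (S : Finset ℕ) (β : List ℕ) : ∀ a, (∀ b ∈ β, 0 < b) →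
    thetaVal S a β = 2 ^ β.length * pkInd S a β := by
  induction β with
  | nil => intro a _; simp [thetaVal, pkInd]
  | cons b β ih =>
    intro a h
    have hb := h b (by simp)
    rw [thetaVal, pkInd, if_neg hb.ne', ih _ (fun x hx => h x (by simp [hx])), List.length_cons]
    ring

theorem thetaVal_filter (S : Finset ℕ) (β : List ℕ) : ∀ a,
    thetaVal S a (β.filter (· ≠ 0)) = thetaVal S a β := by
  induction β with
  | nil => intro a; rfl
  | cons b β ih =>
    intro a
    by_cases hb : b = 0
    · subst hb
      rw [thetaVal, add_zero, if_pos rfl, one_mul, ← ih a]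
      simp
    · rw [List.filter_cons_of_pos (by simpa using hb), thetaVal, thetaVal, ih]

theorem thetaVal_append (S : Finset ℕ) (α X : List ℕ) : ∀ a,
    thetaVal S a (α ++ X) = thetaVal S a α * thetaVal S (a + α.sum) X := by
  induction α with
  | nil => intro a; simp [thetaVal]
  | cons b α ih =>
    intro a
    rw [List.cons_append, thetaVal, thetaVal, ih, List.sum_cons, ← add_assoc, mul_assoc]

/-- A nonzero term at i forces all elements of S in [a+2, a+m] to lie in {a+i, a+i+1}; as S has no
two consecutive elements, there is at most one. If it is s, the cuts i = s - a - 1 and i = s - a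
contribute opposite values ±4. If there is none, the values are 2, -4, 4, …, with final absolute
value 2, and again add up to 0. -/
theorem noneInd_sum_eq_zero {S : Finset ℕ} (hS : ∀ i ∈ S, i - 1 ∉ S) (a m : ℕ) :
    ∑ i ∈ range (m + 2), (-1 : ℚ) ^ i * ((if i = 0 then 1 else 2 * noneInd S (a + 1) (a + i)) *
      (if i = m + 1 then 1 else 2 * noneInd S (a + i + 1) (a + (m + 1)))) = 0 := by
  induction m with
  | zero =>
    rw [sum_range_succ, sum_range_succ, sum_range_zero]
    simp [noneInd_eq_one]
  | succ m ih =>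
    rw [sum_range_succ, sum_range_succ] at ih
    rw [sum_range_succ, sum_range_succ, sum_range_succ]
    have e : ∀ i ∈ range m,
        (-1 : ℚ) ^ i * ((if i = 0 then 1 else 2 * noneInd S (a + 1) (a + i)) *
          (if i = m + 1 + 1 then 1 else 2 * noneInd S (a + i + 1) (a + (m + 1 + 1)))) =
        if a + (m + 1) ∈ S then 0 else
        (-1 : ℚ) ^ i * ((if i = 0 then 1 else 2 * noneInd S (a + 1) (a + i)) *
          (if i = m + 1 then 1 else 2 * noneInd S (a + i + 1) (a + (m + 1)))) := by
      intro i hi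
      rw [mem_range] at hi
      rw [if_neg (show i ≠ m + 1 + 1 by omega), if_neg (show i ≠ m + 1 by omega),
        show a + (m + 1 + 1) = a + (m + 1) + 1 by omega, noneInd_succ (by omega)]
      split_ifs <;> simp
    rw [sum_congr rfl e]
    simp only [show m ≠ m + 1 by omega, show m ≠ m + 1 + 1 by omega, if_false, if_true,
      show m + 1 ≠ 0 by omega, show m + 1 ≠ m + 1 + 1 by omega,
      show m + 1 + 1 ≠ 0 by omega] at ih ⊢
    rw [noneInd_eq_one (show a + (m + 1) ≤ a + m + 1 + 1 by omega)] at ih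
    rw [noneInd_eq_one (show a + (m + 1 + 1) ≤ a + m + 1 + 1 by omega),
      noneInd_eq_one (show a + (m + 1 + 1) ≤ a + (m + 1) + 1 + 1 by omega)]
    -- For m = 0 the point a + 1 is disregarded, so the cut 0 has to be treated apart.
    by_cases hm : m = 0
    · subst hm
      simp only [range_zero, sum_empty]
      rw [noneInd_eq_one (show a + (0 + 1) ≤ a + 1 + 1 by omega),
        noneInd_eq_one (show a + (0 + 1 + 1) ≤ a + 1 + 1 by omega)]
      norm_num
    · rw [if_neg hm, show a + (m + 1 + 1) = a + (m + 1) + 1 by omega,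
        noneInd_succ (b := a + (m + 1)) (by omega)]
      rw [if_neg hm] at ih
      -- If the new point lies in S, only the cuts m and m + 1 can survive, and they cancel because
      -- a + m is not in S. If it does not, the sum has the same value as for m.
      by_cases h : a + (m + 1) ∈ S
      · have h1 : a + m ∉ S := by
          have := hS _ h
          rwa [show a + (m + 1) - 1 = a + m by omega] at this
        have h2 : noneInd S (a + 1) (a + (m + 1)) = noneInd S (a + 1) (a + m) := by
          by_cases hm1 : m = 1
          · rw [noneInd_eq_one (by omega), noneInd_eq_one (by omega)]
          · rw [show a + (m + 1) = a + m + 1 by omega, noneInd_succ (by omega), if_neg h1]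
        simp only [h, if_true, sum_const_zero]
        rw [h2]
        ring
      · simp only [h, if_false]
        linear_combination ih

theorem coefs_Theta {n : ℕ} {S : Finset ℕ} (hS : S ⊆ Icc 1 n) (h1 : 1 ∉ S) (β : List ℕ) :
    coefs (Theta n S) β = if β.sum = n + 1 then thetaVal S 0 β else 0 := by
  split_ifs with h
  · have hp : ∀ b ∈ β.filter (· ≠ 0), 0 < b := by
      intro b hb
      have := (List.mem_filter.1 hb).2
      simp at this; omega
    rw [zeroInsensitive_coefs (Theta n S).2, ← thetaVal_filter, thetaVal_of_pos _ _ _ hp,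
      coefs_Theta_eq_pkInd hS h1 hp]
    rw [sum_filter_ne_zero, h]
  · exact coefs_Theta_of_sum_ne h

theorem euler_Theta {n : ℕ} {S : Finset ℕ} (hS : S ⊆ Icc 1 n) (hs : LeftSparse S) :
    Euler (coefs (Theta n S)) := by
  intro α γ m hm
  obtain ⟨m, rfl⟩ : ∃ k, m = k + 1 := ⟨m - 1, by omega⟩
  by_cases h : (α ++ (m + 1) :: γ).sum = n + 1
  · have e : ∀ p ∈ antidiagonal (m + 1),
        (-1 : ℚ) ^ p.2 * coefs (Theta n S) (α ++ p.1 :: p.2 :: γ) =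
        ((-1 : ℚ) ^ (m + 1) * thetaVal S 0 α * thetaVal S (α.sum + (m + 1)) γ) *
        ((-1 : ℚ) ^ p.1 * ((if p.1 = 0 then 1 else
          2 * noneInd S (α.sum + 1) (α.sum + p.1)) *
        (if p.1 = m + 1 then 1 else
          2 * noneInd S (α.sum + p.1 + 1) (α.sum + (m + 1))))) := by
      rintro ⟨i, j⟩ hp
      rw [HasAntidiagonal.mem_antidiagonal] at hp
      simp only at hp ⊢
      rw [coefs_Theta hS hs.1, if_pos, thetaVal_append, zero_add, thetaVal, thetaVal,
        show α.sum + i + j = α.sum + (m + 1) by omega]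
      · have hj : (if j = 0 then (1 : ℚ) else 2 * noneInd S (α.sum + i + 1) (α.sum + (m + 1))) =
            if i = m + 1 then 1 else 2 * noneInd S (α.sum + i + 1) (α.sum + (m + 1)) := by
          congr 1
          simp only [eq_iff_iff]
          omega
        have hsg : (-1 : ℚ) ^ (m + 1) * (-1) ^ i = (-1) ^ j := by
          rw [← hp, pow_add, mul_right_comm, ← mul_pow]
          simp
        rw [hj, ← hsg]
        ring
      · simp only [List.sum_append, List.sum_cons] at h ⊢
        omega
    rw [sum_congr rfl e, ← mul_sum, Nat.sum_antidiagonal_eq_sum_range_succ_mk,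
      noneInd_sum_eq_zero hs.2, mul_zero]
  · refine sum_eq_zero fun p hp => ?_
    rw [HasAntidiagonal.mem_antidiagonal] at hp
    rw [coefs_Theta_of_sum_ne, mul_zero]
    simp only [List.sum_append, List.sum_cons] at h ⊢
    omega

theorem peak_le_eulerAlgebra : Peak ≤ eulerAlgebra := by
  refine Algebra.adjoin_le ?_
  rintro f ⟨n, S, hS, hs, rfl⟩
  exact mem_eulerAlgebra.2 ⟨(Theta n S).2, euler_Theta hS hs⟩

/-! ### The square of the lift -/

theorem gaps_append_succ (N : ℕ) (l : List ℕ) : ∀ a, (a :: (l ++ [N])).Pairwise (· < ·) →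
    ∃ (δ : List ℕ) (k : ℕ), gaps a (l ++ [N]) = δ ++ [k + 1] ∧
      gaps a (l ++ [N + 1]) = δ ++ [k + 2] := by
  induction l with
  | nil =>
    intro a h
    have h1 : a < N := by simpa using h
    refine ⟨[], N - a - 1, ?_, ?_⟩ <;> simp [gaps] <;> omega
  | cons b l ih =>
    intro a h
    obtain ⟨δ, k, h1, h2⟩ := ih b (List.pairwise_cons.1 h).2
    exact ⟨(b - a) :: δ, k, by simp [gaps, h1], by simp [gaps, h2]⟩

theorem exists_comp_succ {n : ℕ} {S : Finset ℕ} (hS : S ⊆ Icc 1 n) :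
    ∃ (δ : List ℕ) (k : ℕ), comp n S = δ ++ [k + 1] ∧ comp (n + 1) S = δ ++ [k + 2] :=
  gaps_append_succ _ _ _ (pairwise_sort_append hS)

theorem filter_append_succ (α : List ℕ) (m : ℕ) :
    (α ++ [m + 1]).filter (· ≠ 0) = α.filter (· ≠ 0) ++ [m + 1] := by
  simp

/-- L raises the last part of a composition by 1. A positive last entry survives the removal of
zeros, so α may contain zeros. -/
theorem coefs_lift_append (f : QSym) (α : List ℕ) (m : ℕ) :
    coefs (lift f) (α ++ [m + 2]) = coefs f (α ++ [m + 1]) := by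
  have key : (LinearMap.proj (α ++ [m + 2]) ∘ₗ coefs) ∘ₗ QSym.val.toLinearMap ∘ₗ lift =
      (LinearMap.proj (α ++ [m + 1]) ∘ₗ coefs) ∘ₗ QSym.val.toLinearMap := by
    apply basisM.ext
    rintro (_ | ⟨n, S, hS⟩)
    · have h : lift (basisM none) = 0 := by rw [lift, Module.Basis.constr_basis]
      simp only [LinearMap.comp_apply, h]
      rw [basisM_none]
      change coefs 0 (α ++ [m + 2]) = coefs 1 (α ++ [m + 1])
      rw [coefs_one, if_neg (by simp), map_zero]; rfl
    · simp only [LinearMap.comp_apply]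
      rw [basisM_some, lift_M n S hS]
      change coefs (M (n + 1) S) (α ++ [m + 2]) = coefs (M n S) (α ++ [m + 1])
      obtain ⟨δ, k, h1, h2⟩ := exists_comp_succ hS
      rw [coefs_M, coefs_M, h1, h2, filter_append_succ, filter_append_succ]
      congr 1
      rw [eq_iff_iff]
      constructor <;> intro h <;> obtain ⟨h3, h4⟩ := List.append_inj' h rfl <;>
        simp only [List.cons.injEq, and_true] at h4 <;> rw [h3] <;> congr 2 <;> omega
  exact LinearMap.congr_fun key f

theorem coefs_lift_append_one (f : QSym) (α : List ℕ) :
    coefs (lift f) (α ++ [1]) = 0 := by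
  have key : (LinearMap.proj (α ++ [1]) ∘ₗ coefs) ∘ₗ QSym.val.toLinearMap ∘ₗ lift = 0 := by
    apply basisM.ext
    rintro (_ | ⟨n, S, hS⟩)
    · have h : lift (basisM none) = 0 := by rw [lift, Module.Basis.constr_basis]
      simp only [LinearMap.comp_apply, h, map_zero]
      rfl
    · simp only [LinearMap.comp_apply]
      rw [basisM_some, lift_M n S hS]
      change coefs (M (n + 1) S) (α ++ [1]) = 0
      obtain ⟨δ, k, h1, h2⟩ := exists_comp_succ hS
      rw [coefs_M, h2, filter_append_succ, if_neg]
      intro h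
      have := congrArg List.getLast? h
      simp at this
  exact LinearMap.congr_fun key f

theorem coefs_lift_nil (f : QSym) : coefs (lift f) [] = 0 := by
  have key : (LinearMap.proj [] ∘ₗ coefs) ∘ₗ QSym.val.toLinearMap ∘ₗ lift = 0 := by
    apply basisM.ext
    rintro (_ | ⟨n, S, hS⟩)
    · have h : lift (basisM none) = 0 := by rw [lift, Module.Basis.constr_basis]
      simp only [LinearMap.comp_apply, h, map_zero]
      rfl
    · simp only [LinearMap.comp_apply]
      rw [basisM_some, lift_M n S hS]
      change coefs (M (n + 1) S) [] = 0
      rw [coefs_M, if_neg]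
      exact fun h => comp_ne_nil _ _ h.symm
  exact LinearMap.congr_fun key f

/-- The relation between the coefficients of `f` and of `L²(f)`. -/
structure DoubleShift (c c' : List ℕ → ℚ) : Prop where
  one : ∀ α, c' (α ++ [1]) = 0
  two : ∀ α, c' (α ++ [2]) = 0
  add : ∀ α m, c' (α ++ [m + 3]) = c (α ++ [m + 1])

theorem doubleShift_lift (f : QSym) : DoubleShift (coefs f) (coefs (lift (lift f))) where
  one := coefs_lift_append_one _
  two α := by rw [coefs_lift_append _ α 0]; exact coefs_lift_append_one _ _
  add α m := by rw [coefs_lift_append, coefs_lift_append]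

/-- A last entry 0 can be removed, and every other last entry is governed by the relation; so only
the value at the empty list is free. -/
theorem DoubleShift.unique {c c₁ c₂ : List ℕ → ℚ} (h₁ : DoubleShift c c₁)
    (h₂ : DoubleShift c c₂) (z₁ : ZeroInsensitive c₁) (z₂ : ZeroInsensitive c₂)
    (h : c₁ [] = c₂ []) : c₁ = c₂ := by
  funext β
  induction β using List.reverseRecOn with
  | nil => exact h
  | append_singleton α m ih =>
    match m with
    | 0 => rw [z₁.insert_zero, z₂.insert_zero, List.append_nil, ih]
    | 1 => rw [h₁.one, h₂.one]
    | 2 => rw [h₁.two, h₂.two]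
    | m + 3 => rw [h₁.add, h₂.add]

/-- The reason for using L² instead of L: splitting the last exponent commutes with a shift by 2
because ε² = 1. Taking ε = -1 serves the Euler relations and ε = 1 the duplication of variables. -/
theorem DoubleShift.sum_antidiagonal {c c' : List ℕ → ℚ} (h : DoubleShift c c')
    (z : ZeroInsensitive c) (z' : ZeroInsensitive c') (ε : ℚ) (hε : ε ^ 2 = 1) (α : List ℕ)
    (m : ℕ) : ∑ p ∈ antidiagonal (m + 3), ε ^ p.2 * c' (α ++ [p.1, p.2]) =
      ∑ p ∈ antidiagonal (m + 1), ε ^ p.2 * c (α ++ [p.1, p.2]) := by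
  have z0 : ∀ {b : List ℕ → ℚ}, ZeroInsensitive b → ∀ k, b (α ++ [k, 0]) = b (α ++ [k]) := by
    intro b hb k
    have := hb.insert_zero (α ++ [k]) []
    simpa using this
  have app : ∀ i j : ℕ, α ++ [i, j] = (α ++ [i]) ++ [j] := by simp
  rw [← Nat.sum_antidiagonal_swap, Nat.sum_antidiagonal_eq_sum_range_succ_mk,
    ← Nat.sum_antidiagonal_swap (n := m + 1), Nat.sum_antidiagonal_eq_sum_range_succ_mk]
  simp only [Prod.swap]
  -- Indexed by the last entry j, the terms j = 1, 2 of c' vanish, j = 0 matches j = 0 of c, and j =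
  -- k + 3 matches j = k + 1.
  rw [sum_range_succ', sum_range_succ', sum_range_succ', sum_range_succ' (n := m + 1)]
  simp only [Nat.sub_zero, zero_add, z0 z, z0 z', h.add, app _ 1, app _ (1 + 1), h.one, h.two,
    mul_zero, add_zero]
  congr 1
  refine sum_congr rfl fun k _ => ?_
  rw [app, show k + 1 + 1 + 1 = k + 3 by rfl, h.add, app, pow_add, pow_add,
    show m + 3 - (k + 3) = m + 1 - (k + 1) by omega, show ε ^ 3 = ε ^ 1 * ε ^ 2 by ring, hε,
    mul_one]

theorem DoubleShift.sum_antidiagonal_small {c c' : List ℕ → ℚ} (h : DoubleShift c c')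
    (z' : ZeroInsensitive c') (ε : ℚ) (α : List ℕ) (m : ℕ) (hm : m = 1 ∨ m = 2) :
    ∑ p ∈ antidiagonal m, ε ^ p.2 * c' (α ++ [p.1, p.2]) = 0 := by
  have h1 : ∀ i, c' (α ++ [i, 1]) = 0 := fun i => by simpa using h.one (α ++ [i])
  have h2 : ∀ i, c' (α ++ [i, 2]) = 0 := fun i => by simpa using h.two (α ++ [i])
  have h3 : ∀ i, c' (α ++ [i, 0]) = c' (α ++ [i]) := fun i => by
    simpa using z'.insert_zero (α ++ [i]) []
  refine sum_eq_zero ?_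
  rintro ⟨i, j⟩ hp
  rw [HasAntidiagonal.mem_antidiagonal] at hp
  simp only at hp ⊢
  have hj : j = 0 ∨ j = 1 ∨ j = 2 := by omega
  rcases hj with rfl | rfl | rfl
  · rcases hm with rfl | rfl
    · obtain rfl : i = 1 := by omega
      rw [h3, h.one, mul_zero]
    · obtain rfl : i = 2 := by omega
      rw [h3, h.two, mul_zero]
  · rw [h1, mul_zero]
  · rw [h2, mul_zero]

/-- A relation not involving the last exponent is simply transported by the shift; one that splits
the last exponent is the preceding computation with ε = -1. -/
theorem DoubleShift.euler {c c' : List ℕ → ℚ} (h : DoubleShift c c') (z : ZeroInsensitive c)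
    (z' : ZeroInsensitive c') (he : Euler c) : Euler c' := by
  intro α γ m hm
  have app : ∀ (i j : ℕ) (δ : List ℕ) (k : ℕ),
      α ++ i :: j :: (δ ++ [k]) = (α ++ i :: j :: δ) ++ [k] := by simp
  induction γ using List.reverseRecOn with
  | nil =>
    match m with
    | 1 => exact h.sum_antidiagonal_small z' _ _ _ (by simp)
    | 2 => exact h.sum_antidiagonal_small z' _ _ _ (by simp)
    | m + 3 =>
      rw [h.sum_antidiagonal z z' (-1) (by norm_num)]
      exact he α [] (m + 1) (by omega)
  | append_singleton δ k ih =>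
    simp only [app]
    match k with
    | 0 =>
      rw [← ih]
      refine sum_congr rfl fun p _ => ?_
      rw [z'.insert_zero, List.append_nil]
    | 1 => simp only [h.one, mul_zero, sum_const_zero]
    | 2 => simp only [h.two, mul_zero, sum_const_zero]
    | k + 3 =>
      simp only [h.add]
      simpa only [app] using he α (δ ++ [k + 1]) m hm

/-! ### The double shift commutes with the duplication of variables -/

theorem DoubleShift.tail {c c' : List ℕ → ℚ} (h : DoubleShift c c') (m : ℕ) :
    DoubleShift (headOp m c) (headOp m c') where
  one α := h.one (m :: α)
  two α := h.two (m :: α)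
  add α k := h.add (m :: α) k

theorem dbl_singleton (m : ℕ) (c : List ℕ → ℚ) :
    dbl [m] c = ∑ p ∈ antidiagonal m, (1 : ℚ) ^ p.2 * c ([] ++ [p.1, p.2]) := by
  simp [dbl]

theorem DoubleShift.dbl_small {m : ℕ} (hm : m = 1 ∨ m = 2) (α : List ℕ) :
    ∀ {c c' : List ℕ → ℚ}, DoubleShift c c' → ZeroInsensitive c' → dbl (α ++ [m]) c' = 0 := by
  induction α with
  | nil =>
    intro c c' h z'
    rw [List.nil_append, dbl_singleton, h.sum_antidiagonal_small z' _ _ _ hm]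
  | cons a α ih =>
    intro c c' h z'
    rw [List.cons_append, dbl]
    exact sum_eq_zero fun p _ => ih ((h.tail p.1).tail p.2) ((z'.tail _).tail _)

theorem DoubleShift.dbl_add (m : ℕ) (α : List ℕ) :
    ∀ {c c' : List ℕ → ℚ}, DoubleShift c c' → ZeroInsensitive c → ZeroInsensitive c' →
    dbl (α ++ [m + 3]) c' = dbl (α ++ [m + 1]) c := by
  induction α with
  | nil =>
    intro c c' h z z'
    rw [List.nil_append, List.nil_append, dbl_singleton, dbl_singleton,
      h.sum_antidiagonal z z' 1 (by norm_num)]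
  | cons a α ih =>
    intro c c' h z z'
    rw [List.cons_append, List.cons_append, dbl, dbl]
    exact sum_congr rfl fun p _ =>
      ih ((h.tail p.1).tail p.2) ((z.tail _).tail _) ((z'.tail _).tail _)

theorem DoubleShift.dbl {c c' : List ℕ → ℚ} (h : DoubleShift c c') (z : ZeroInsensitive c)
    (z' : ZeroInsensitive c') : DoubleShift (fun β => dbl β c) (fun β => dbl β c') where
  one α := h.dbl_small (by simp) α z'
  two α := h.dbl_small (by simp) α z'
  add α m := h.dbl_add m α z z'

theorem coe_lift_lift_mem {f : QSym} (hf : (f : MvPowerSeries ℕ ℚ) ∈ eulerAlgebra) :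
    (lift (lift f) : MvPowerSeries ℕ ℚ) ∈ eulerAlgebra :=
  mem_eulerAlgebra.2 ⟨(lift (lift f)).2, (doubleShift_lift f).euler (zeroInsensitive_coefs f.2)
    (zeroInsensitive_coefs (lift (lift f)).2) (mem_eulerAlgebra.1 hf).2⟩

/-- Both sides are double shifts of the duplication of f without constant term, hence equal by
uniqueness. -/
theorem stembridge_lift_lift {f : QSym} (hf : (f : MvPowerSeries ℕ ℚ) ∈ eulerAlgebra) :
    (stembridge (lift (lift f)) : MvPowerSeries ℕ ℚ) =
      lift (lift (Subalgebra.inclusion peak_le_qsym (stembridge f))) := by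
  have z := zeroInsensitive_coefs f.2
  have z' := zeroInsensitive_coefs (lift (lift f)).2
  have e : ∀ {g : QSym}, (g : MvPowerSeries ℕ ℚ) ∈ eulerAlgebra →
      coefs (stembridge g) = fun β => PeakAlgebra.dbl β (coefs g) := by
    intro g hg
    rw [stembridge_eq_duplicate g (mem_eulerAlgebra.1 hg).2]
    exact funext fun β => coefs_duplicate _ _
  have h1 := (doubleShift_lift f).dbl z z'
  rw [← e hf, ← e (coe_lift_lift_mem hf)] at h1
  apply coefs_injective
  refine h1.unique (doubleShift_lift (Subalgebra.inclusion peak_le_qsym (stembridge f)))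
    (zeroInsensitive_coefs (peak_le_qsym (stembridge _).2))
    (zeroInsensitive_coefs (lift (lift _)).2) ?_
  rw [coefs_lift_nil, coefs_stembridge _ (by simp), peakVal_nil, coefs_lift_nil]

/-! ### The eigenvectors -/

theorem leftSparse_empty : LeftSparse ∅ := ⟨by simp, by simp⟩

theorem thetaOne_mem_peak : (ThetaOne : MvPowerSeries ℕ ℚ) ∈ Peak :=
  Algebra.subset_adjoin ⟨0, ∅, empty_subset _, leftSparse_empty, rfl⟩

theorem wordOp_mem_eulerAlgebra (w : CDWord) {f : QSym}
    (hf : (f : MvPowerSeries ℕ ℚ) ∈ eulerAlgebra) :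
    (wordOp w f : MvPowerSeries ℕ ℚ) ∈ eulerAlgebra := by
  induction w with
  | nil => exact hf
  | cons l w ih =>
    cases l with
    | c => exact mul_mem (peak_le_eulerAlgebra thetaOne_mem_peak) ih
    | d => exact coe_lift_lift_mem ih

theorem omega_mem_eulerAlgebra (w : CDWord) : (Omega w : MvPowerSeries ℕ ℚ) ∈ eulerAlgebra :=
  wordOp_mem_eulerAlgebra w (peak_le_eulerAlgebra thetaOne_mem_peak)

theorem thetaOne_eq : ThetaOne = (2 : ℚ) • M 0 ∅ := by
  simp [ThetaOne, Theta]

theorem stembridge_thetaOne : (stembridge ThetaOne : MvPowerSeries ℕ ℚ) =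
    (2 : ℚ) • (ThetaOne : MvPowerSeries ℕ ℚ) := by
  have h : F 0 ∅ = M 0 ∅ := by
    simp [F]
  rw [thetaOne_eq, map_smul, ← h]
  change (2 : ℚ) • (stembridge (F 0 ∅) : MvPowerSeries ℕ ℚ) = _
  rw [stembridge_F 0 ∅ (empty_subset _)]
  have h2 : Theta 0 (Lam ∅) = ThetaOne := rfl
  rw [h2, thetaOne_eq, h]

theorem stembridge_omega (w : CDWord) : (stembridge (Omega w) : MvPowerSeries ℕ ℚ) =
    (2 : ℚ) ^ (cCount w + 1) • (Omega w : MvPowerSeries ℕ ℚ) := by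
  induction w with
  | nil => simpa [cCount, Omega, wordOp] using stembridge_thetaOne
  | cons l w ih =>
    have hw := omega_mem_eulerAlgebra w
    cases l with
    | c =>
      have e : Omega (Letter.c :: w) = ThetaOne * Omega w := rfl
      have h1 := stembridge_eq_duplicate _ (mem_eulerAlgebra.1 hw).2
      have h2 := stembridge_eq_duplicate _
        (mem_eulerAlgebra.1 (peak_le_eulerAlgebra thetaOne_mem_peak)).2
      have h3 := stembridge_eq_duplicate _
        (mem_eulerAlgebra.1 (omega_mem_eulerAlgebra (Letter.c :: w))).2
      -- Multiplicativity of ϑ on Eulerian functions, through the substitution homomorphism.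
      rw [h3, e, Subalgebra.coe_mul, map_mul, ← h1, ← h2, ih, stembridge_thetaOne, smul_mul_smul_comm,
        cCount]
      congr 1
      ring
    | d =>
      have e : Omega (Letter.d :: w) = lift (lift (Omega w)) := rfl
      have h : Subalgebra.inclusion peak_le_qsym (stembridge (Omega w)) =
          (2 : ℚ) ^ (cCount w + 1) • Omega w := Subtype.ext ih
      rw [e, stembridge_lift_lift hw, h, map_smul, map_smul, cCount]
      rfl

/-! ### Homogeneous components -/

theorem degree_toFinsupp (β : List ℕ) : β.toFinsupp.degree = β.sum := by
  rw [← sum_exps, exps_toFinsupp_filter, sum_filter_ne_zero]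

theorem isHomogeneous_iff {f : MvPowerSeries ℕ ℚ} {N : ℕ} :
    f.IsHomogeneous N ↔ ∀ β : List ℕ, β.sum ≠ N → coefs f β = 0 := by
  constructor
  · intro h β hβ
    exact h.coeff_eq_zero (by rwa [degree_toFinsupp])
  · intro h x hx
    obtain ⟨β, -, rfl⟩ := exists_toFinsupp x 0
    have hw : Finsupp.weight 1 β.toFinsupp = β.sum := by
      rw [← degree_toFinsupp, Finsupp.degree_eq_weight_one]; rfl
    rw [hw]
    by_contra hne
    exact hx (h β hne)

/-- The elements of the Euler algebra that are homogeneous of degree `N`. -/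
def eulerDeg (N : ℕ) : Submodule ℚ (MvPowerSeries ℕ ℚ) where
  carrier := {f | f ∈ eulerAlgebra ∧ ∀ β : List ℕ, β.sum ≠ N → coefs f β = 0}
  add_mem' := by
    rintro f g ⟨hf, hf'⟩ ⟨hg, hg'⟩
    refine ⟨add_mem hf hg, fun β hβ => ?_⟩
    rw [map_add, Pi.add_apply, hf' β hβ, hg' β hβ, add_zero]
  zero_mem' := ⟨zero_mem _, fun β _ => by rw [map_zero]; rfl⟩
  smul_mem' := by
    rintro r f ⟨hf, hf'⟩
    refine ⟨eulerAlgebra.smul_mem hf r, fun β hβ => ?_⟩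
    rw [map_smul, Pi.smul_apply, hf' β hβ, smul_zero]

theorem mem_eulerDeg {N : ℕ} {f : MvPowerSeries ℕ ℚ} :
    f ∈ eulerDeg N ↔ f ∈ eulerAlgebra ∧ ∀ β : List ℕ, β.sum ≠ N → coefs f β = 0 := Iff.rfl

theorem coefs_homogeneousComponent (N : ℕ) (f : MvPowerSeries ℕ ℚ) (β : List ℕ) :
    coefs (f.homogeneousComponent N) β = if β.sum = N then coefs f β else 0 := by
  rw [coefs_apply, MvPowerSeries.coeff_homogeneousComponent, degree_toFinsupp]
  rfl

theorem homogeneousComponent_mem_eulerDeg {f : MvPowerSeries ℕ ℚ} (hf : f ∈ eulerAlgebra)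
    (N : ℕ) : f.homogeneousComponent N ∈ eulerDeg N := by
  obtain ⟨⟨⟨d, hd⟩, hq⟩, he⟩ := mem_eulerAlgebra.1 hf
  refine ⟨mem_eulerAlgebra.2 ⟨⟨⟨d, fun m hm => hd m fun h => hm ?_⟩, fun m m' h => ?_⟩,
    fun α γ m hm => ?_⟩, fun β hβ => ?_⟩
  · rw [MvPowerSeries.coeff_homogeneousComponent, h, ite_self]
  · rw [MvPowerSeries.coeff_homogeneousComponent, MvPowerSeries.coeff_homogeneousComponent,
      ← sum_exps, ← sum_exps, h, hq m m' h]
  · have e : ∀ p ∈ antidiagonal m,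
        (-1 : ℚ) ^ p.2 * coefs (f.homogeneousComponent N) (α ++ p.1 :: p.2 :: γ) =
        if (α ++ m :: γ).sum = N then (-1 : ℚ) ^ p.2 * coefs f (α ++ p.1 :: p.2 :: γ) else 0 := by
      intro p hp
      rw [HasAntidiagonal.mem_antidiagonal] at hp
      have hs : (α ++ p.1 :: p.2 :: γ).sum = (α ++ m :: γ).sum := by
        simp only [List.sum_append, List.sum_cons]; omega
      rw [coefs_homogeneousComponent, hs, mul_ite, mul_zero]
    rw [sum_congr rfl e]
    split_ifs
    · exact he α γ m hm
    · exact sum_const_zero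
  · rw [coefs_homogeneousComponent, if_neg hβ]

/-- Bounded degree makes f a finite sum of homogeneous components. They are again Eulerian because
each Euler relation involves lists of a single sum. -/
theorem eulerAlgebra_le_of_eulerDeg_le {V : Submodule ℚ (MvPowerSeries ℕ ℚ)} (h1 : 1 ∈ V)
    (h : ∀ n, eulerDeg (n + 1) ≤ V) : Subalgebra.toSubmodule eulerAlgebra ≤ V := by
  intro f hf
  obtain ⟨⟨⟨d, hd⟩, hq⟩, he⟩ := mem_eulerAlgebra.1 hf
  have e : f = ∑ N ∈ range (d + 1), f.homogeneousComponent N := by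
    ext m
    rw [map_sum]
    simp only [MvPowerSeries.coeff_homogeneousComponent]
    rw [sum_ite_eq]
    split_ifs with hm
    · rfl
    · by_contra hne
      exact hm (mem_range.2 (Nat.lt_succ_of_le (hd m hne)))
  rw [e]
  refine V.sum_mem fun N _ => ?_
  cases N with
  | zero =>
    have h0 : f.homogeneousComponent 0 = MvPowerSeries.constantCoeff f • 1 := by
      ext m
      rw [MvPowerSeries.coeff_homogeneousComponent, map_smul, MvPowerSeries.coeff_one]
      by_cases hm : m = 0
      · rw [if_pos (by rw [hm, map_zero]), if_pos hm, hm, smul_eq_mul, mul_one]; rfl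
      · rw [if_neg (by rwa [Finsupp.degree_eq_zero_iff]), if_neg hm, smul_zero]
    rw [h0]
    exact V.smul_mem _ h1
  | succ n => exact h n (homogeneousComponent_mem_eulerDeg hf _)

/-! ### The dimension bound -/

/-- An even exponent can be traded for longer lists: in its Euler relation the terms (m, 0) and (0,
m) both equal c(…, m, …) with sign +1, and all other terms split m into two positive parts. -/
theorem Euler.eq_zero_of_odd {c : List ℕ → ℚ} (h : Euler c) (z : ZeroInsensitive c) {N : ℕ}
    (h0 : ∀ β : List ℕ, (∀ b ∈ β, Odd b) → β.sum = N → c β = 0) (β : List ℕ)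
    (hs : β.sum = N) : c β = 0 := by
  -- Downward induction on the length; k bounds N minus the length. At length N all entries are 1,
  -- hence odd.
  have key : ∀ k, ∀ β : List ℕ, (∀ b ∈ β, 0 < b) → β.sum = N → N ≤ β.length + k → c β = 0 := by
    intro k
    induction k with
    | zero =>
      intro β hp hs hl
      refine h0 β (fun b hb => ?_) hs
      obtain ⟨α, γ, rfl⟩ := List.append_of_mem hb
      have h1 := List.length_le_sum_of_one_le α fun i hi => hp i (by simp [hi])
      have h2 := List.length_le_sum_of_one_le γ fun i hi => hp i (by simp [hi])
      have hb' := hp b hb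
      simp only [List.sum_append, List.sum_cons, List.length_append, List.length_cons] at hs hl
      obtain rfl : b = 1 := by omega
      exact odd_one
    | succ k ih =>
      intro β hp hs hl
      by_cases hodd : ∀ b ∈ β, Odd b
      · exact h0 β hodd hs
      · push Not at hodd
        obtain ⟨b, hb, hev⟩ := hodd
        have hb0 := hp b hb
        obtain ⟨α, γ, rfl⟩ := List.append_of_mem hb
        obtain ⟨m, rfl⟩ : ∃ m, b = m + 1 := ⟨b - 1, by omega⟩
        have hE := h α γ (m + 1) (by omega)
        rw [Nat.sum_antidiagonal_eq_sum_range_succ_mk, sum_range_succ, sum_range_succ',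
          sum_eq_zero] at hE
        · simp only [Nat.sub_zero, Nat.sub_self, pow_zero, one_mul, zero_add, z.insert_zero] at hE
          have h1 := z.insert_zero (α ++ [m + 1]) γ
          simp only [List.append_assoc, List.cons_append, List.nil_append] at h1
          rw [h1, (Nat.not_odd_iff_even.1 hev).neg_one_pow, one_mul] at hE
          linarith
        · intro i hi
          rw [mem_range] at hi
          rw [ih, mul_zero]
          · intro x hx
            simp only [List.mem_append, List.mem_cons] at hx
            rcases hx with hx | rfl | rfl | hx
            · exact hp x (by simp [hx])
            · omega
            · omega
            · exact hp x (by simp [hx])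
          · simp only [List.sum_append, List.sum_cons] at hs ⊢
            omega
          · simp only [List.length_append, List.length_cons] at hl ⊢
            omega
  rw [z]
  refine key N _ (fun b hb => ?_) (by rw [sum_filter_ne_zero, hs]) (by omega)
  have := (List.mem_filter.1 hb).2
  simp at this; omega

/-- The list of odd numbers attached to a word: `c` prepends a `1` and `d` adds `2` to the first
entry. -/
def oddList : CDWord → List ℕ
  | [] => [1]
  | Letter.c :: w => 1 :: oddList w
  | Letter.d :: w => (oddList w).modifyHead (· + 2)

/-- Reading off the first part: a 1 gives the letter c, a larger odd part is reduced by 2 and gives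
d. Surjectivity suffices for the upper bound on the dimension. -/
theorem exists_oddList (N : ℕ) : ∀ β : List ℕ, (∀ b ∈ β, Odd b) → β.sum = N + 1 →
    ∃ w, wordDeg w = N ∧ oddList w = β := by
  induction N using Nat.strong_induction_on with
  | _ N ih =>
    intro β ho hs
    match β with
    | [] => simp at hs
    | 0 :: β => exact absurd (ho 0 (by simp)) (by decide)
    | 1 :: β =>
      rw [List.sum_cons] at hs
      cases N with
      | zero =>
        refine ⟨[], rfl, ?_⟩
        cases β with
        | nil => rfl
        | cons b β =>
          have := (ho b (by simp)).pos
          rw [List.sum_cons] at hs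
          omega
      | succ N =>
        obtain ⟨w, h1, h2⟩ := ih N (by omega) β (fun b hb => ho b (by simp [hb])) (by omega)
        exact ⟨Letter.c :: w, by rw [wordDeg, h1], by rw [oddList, h2]⟩
    | (b + 2) :: β =>
      have hb : Odd b := by
        have := ho (b + 2) (by simp)
        rw [Nat.odd_iff] at this ⊢
        omega
      have := hb.pos
      rw [List.sum_cons] at hs
      obtain ⟨N, rfl⟩ : ∃ k, N = k + 2 := ⟨N - 2, by omega⟩
      obtain ⟨w, h1, h2⟩ := ih N (by omega) (b :: β)
        (fun x hx => by
          rcases List.mem_cons.1 hx with rfl | hx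
          · exact hb
          · exact ho x (by simp [hx]))
        (by rw [List.sum_cons]; omega)
      exact ⟨Letter.d :: w, by rw [wordDeg, h1], by rw [oddList, h2]; rfl⟩

/-- The words of degree `n`. -/
abbrev Word (n : ℕ) : Type := {w : CDWord // wordDeg w = n}

theorem length_le_wordDeg (w : CDWord) : w.length ≤ wordDeg w := by
  induction w with
  | nil => simp
  | cons l w ih => cases l <;> simp only [wordDeg, List.length_cons] <;> omega

instance : Finite Letter :=
  Finite.of_injective (fun l : Letter => match l with | .c => true | .d => false) (by
    intro a b h
    cases a <;> cases b <;> simp_all)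

instance (n : ℕ) : Finite (Word n) :=
  Set.Finite.subset (List.finite_length_le Letter n) fun w (hw : wordDeg w = n) =>
    hw ▸ length_le_wordDeg w

instance (n : ℕ) : Fintype (Word n) := Fintype.ofFinite _

/-- The coefficients at the lists of odd numbers. -/
def oddCoefs (n : ℕ) : eulerDeg (n + 1) →ₗ[ℚ] (Word n → ℚ) :=
  LinearMap.pi fun w => (LinearMap.proj (oddList w.1) ∘ₗ coefs) ∘ₗ (eulerDeg (n + 1)).subtype

theorem oddCoefs_injective (n : ℕ) : Function.Injective (oddCoefs n) := by
  rw [← LinearMap.ker_eq_bot, LinearMap.ker_eq_bot']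
  rintro ⟨f, hf, hs⟩ h
  obtain ⟨hq, he⟩ := mem_eulerAlgebra.1 hf
  apply Subtype.ext
  apply coefs_injective
  funext β
  rw [Submodule.coe_zero, map_zero]
  by_cases hβ : β.sum = n + 1
  · refine he.eq_zero_of_odd (zeroInsensitive_coefs hq) (fun β ho hβ => ?_) β hβ
    obtain ⟨w, hw, rfl⟩ := exists_oddList n β ho hβ
    exact congrFun h ⟨w, hw⟩
  · exact hs β hβ

/-- The space embeds into the functions on `Word n`, so an independent family of that size already
exhausts it. -/
theorem eulerDeg_le_span {n : ℕ} {v : Word n → MvPowerSeries ℕ ℚ} (hv : LinearIndependent ℚ v)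
    (hm : ∀ w, v w ∈ eulerDeg (n + 1)) : eulerDeg (n + 1) ≤ Submodule.span ℚ (Set.range v) := by
  have : FiniteDimensional ℚ (eulerDeg (n + 1)) :=
    FiniteDimensional.of_injective _ (oddCoefs_injective n)
  let v' : Word n → eulerDeg (n + 1) := fun w => ⟨v w, hm w⟩
  have hv' : LinearIndependent ℚ v' := LinearIndependent.of_comp (eulerDeg (n + 1)).subtype hv
  have h1 : Module.finrank ℚ (eulerDeg (n + 1)) ≤ Fintype.card (Word n) := by
    have := LinearMap.finrank_le_finrank_of_injective (oddCoefs_injective n)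
    rwa [Module.finrank_fintype_fun_eq_card] at this
  have h2 := hv'.fintype_card_le_finrank
  have h3 := hv'.span_eq_top_of_card_eq_finrank' (le_antisymm h2 h1)
  intro f hf
  have h4 : (⟨f, hf⟩ : eulerDeg (n + 1)) ∈ Submodule.span ℚ (Set.range v') := h3 ▸ trivial
  have h5 := Submodule.mem_map_of_mem (f := (eulerDeg (n + 1)).subtype) h4
  rw [Submodule.map_span, ← Set.range_comp] at h5
  exact h5

/-! ### Independence of the functions `Θ_S` -/

/-- The left sparse set attached to a word. -/
def peakSet : CDWord → Finset ℕ
  | [] => ∅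
  | Letter.c :: w => peakSet w
  | Letter.d :: w => insert (wordDeg w + 2) (peakSet w)

theorem peakSet_subset (w : CDWord) : peakSet w ⊆ Icc 1 (wordDeg w) := by
  induction w with
  | nil => exact empty_subset _
  | cons l w ih =>
    intro i hi
    cases l with
    | c =>
      have := mem_Icc.1 (ih hi)
      rw [wordDeg, mem_Icc]; omega
    | d =>
      rw [wordDeg, mem_Icc]
      rcases mem_insert.1 hi with rfl | hi
      · omega
      · have := mem_Icc.1 (ih hi)
        omega

theorem peakSet_leftSparse (w : CDWord) : LeftSparse (peakSet w) := by
  induction w with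
  | nil => exact leftSparse_empty
  | cons l w ih =>
    cases l with
    | c => exact ih
    | d =>
      have hb : ∀ i ∈ peakSet w, i ≤ wordDeg w := fun i hi => (mem_Icc.1 (peakSet_subset w hi)).2
      refine ⟨fun h => ?_, fun i hi h => ?_⟩
      · rcases mem_insert.1 h with h | h
        · omega
        · exact ih.1 h
      · rcases mem_insert.1 hi with rfl | hi <;> rcases mem_insert.1 h with h | h
        · omega
        · have := hb _ h; omega
        · have := hb _ hi; omega
        · exact ih.2 i hi h

/-- For a nonempty word the first letter is d exactly when the degree of the word belongs to the
set. -/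
theorem peakSet_injective : ∀ w w' : CDWord, wordDeg w = wordDeg w' → peakSet w = peakSet w' →
    w = w' := by
  intro w
  have top : ∀ v, wordDeg v + 2 ∉ peakSet v := fun v h => by
    have := mem_Icc.1 (peakSet_subset v h); omega
  have cd : ∀ v v', wordDeg (Letter.c :: v) = wordDeg (Letter.d :: v') →
      peakSet (Letter.c :: v) ≠ peakSet (Letter.d :: v') := by
    intro v v' hd h
    have h1 : wordDeg v' + 2 ∈ peakSet (Letter.c :: v) := h ▸ mem_insert_self _ _
    have := mem_Icc.1 (peakSet_subset v h1)
    simp only [wordDeg] at hd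
    omega
  induction w with
  | nil =>
    intro w' hd _
    match w' with
    | [] => rfl
    | Letter.c :: w' => simp [wordDeg] at hd
    | Letter.d :: w' => simp [wordDeg] at hd
  | cons l w ih =>
    intro w' hd h
    match l, w' with
    | .c, [] => simp [wordDeg] at hd
    | .d, [] => simp [wordDeg] at hd
    | .c, .c :: w' => rw [ih w' (by simpa [wordDeg] using hd) h]
    | .c, .d :: w' => exact absurd h (cd _ _ hd)
    | .d, .c :: w' => exact absurd h.symm (cd _ _ hd.symm)
    | .d, .d :: w' =>
      have hd' : wordDeg w = wordDeg w' := by simpa [wordDeg] using hd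
      rw [ih w' hd']
      have h' : insert (wordDeg w + 2) (peakSet w) = insert (wordDeg w' + 2) (peakSet w') := h
      rw [← hd'] at h'
      have h2 := congrArg (fun s => s.erase (wordDeg w + 2)) h'
      rwa [erase_insert (top w), hd', erase_insert (top w')] at h2

/-- The hypothesis says that s or s + 1 lies in T for each s ∈ S. Moving s to that element is
injective because S has no consecutive elements, and it never decreases s; as S ≠ T, either some
element moves or a positive element of T is missed. -/
theorem LeftSparse.sum_lt {S T : Finset ℕ} (hS : LeftSparse S) (hT : LeftSparse T)
    (h : S ⊆ T.image (· - 1) ∪ (T.image (· - 1)).image (· + 1)) (hne : S ≠ T) :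
    ∑ s ∈ S, s < ∑ t ∈ T, t := by
  have hT0 : ∀ t ∈ T, t ≠ 0 := by
    rintro t ht rfl
    exact hT.2 0 ht ht
  let g : ℕ → ℕ := fun s => if s ∈ T then s else s + 1
  have hg : ∀ s ∈ S, g s ∈ T := by
    intro s hs
    simp only [g]
    split_ifs with hsT
    · exact hsT
    · have := h hs
      simp only [mem_union, mem_image] at this
      rcases this with ⟨t, ht, rfl⟩ | ⟨_, ⟨t, ht, rfl⟩, rfl⟩
      · have := hT0 t ht
        rwa [show t - 1 + 1 = t by omega]
      · have := hT0 t ht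
        rw [show t - 1 + 1 = t by omega] at hsT
        exact absurd ht hsT
  have hinj : Set.InjOn g S := by
    intro s hs s' hs' he
    have h1 := hS.2 s hs
    have h2 := hS.2 s' hs'
    simp only [g] at he
    split_ifs at he with c1 c2 c2
    · exact he
    · rw [he] at h1
      exact absurd (by simpa using hs') h1
    · rw [← he] at h2
      exact absurd (by simpa using hs) h2
    · omega
  have hle : ∀ s ∈ S, s ≤ g s := by
    intro s _
    simp only [g]
    split_ifs <;> omega
  have himg : S.image g ⊆ T := by
    intro t ht
    obtain ⟨s, hs, rfl⟩ := mem_image.1 ht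
    exact hg s hs
  by_cases hsub : S ⊆ T
  · obtain ⟨t, ht, htS⟩ := exists_of_ssubset (hsub.ssubset_of_ne hne)
    exact sum_lt_sum_of_subset hsub ht htS (Nat.pos_of_ne_zero (hT0 t ht)) (fun _ _ _ => Nat.zero_le _)
  · obtain ⟨s, hs, hsT⟩ := not_subset.1 hsub
    calc ∑ s ∈ S, s < ∑ s ∈ S, g s := sum_lt_sum hle ⟨s, hs, by simp [g, hsT]⟩
      _ = ∑ t ∈ S.image g, t := (sum_image (f := fun t => t) hinj).symm
      _ ≤ ∑ t ∈ T, t := sum_le_sum_of_subset himg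

/-- Triangularity with respect to the sum of the elements of the left sparse set. -/
theorem linearIndependent_Theta (n : ℕ) : LinearIndependent ℚ
    (fun w : Word n => (Theta n (peakSet w.1) : MvPowerSeries ℕ ℚ)) := by
  rw [linearIndependent_iff']
  intro s a h
  have key : ∀ k, ∀ w ∈ s, ∑ i ∈ peakSet w.1, i = k → a w = 0 := by
    intro k
    induction k using Nat.strong_induction_on with
    | _ k ih =>
      intro w hw hk
      -- At this T the function of w has a nonzero coefficient, and any other left sparse set
      -- contributing there has a smaller sum. It lies in [n] because left sparse subsets of [n]
      -- avoid 1.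
      set T := (peakSet w.1).image (· - 1) with hTdef
      have hsub : ∀ v : Word n, peakSet v.1 ⊆ Icc 1 n := fun v => by
        have := peakSet_subset v.1
        rwa [v.2] at this
      have hsp := peakSet_leftSparse w.1
      have hpos : ∀ i ∈ peakSet w.1, 2 ≤ i ∧ i ≤ n := by
        intro i hi
        have h1 := mem_Icc.1 (hsub w hi)
        have h2 : i ≠ 1 := fun h => hsp.1 (h ▸ hi)
        omega
      have hT : T ⊆ Icc 1 n := by
        intro i hi
        obtain ⟨t, ht, rfl⟩ := mem_image.1 hi
        have := hpos t ht
        rw [mem_Icc]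
        omega
      have hcov : peakSet w.1 ⊆ T ∪ T.image (· + 1) := by
        intro i hi
        refine mem_union_right _ (mem_image.2 ⟨i - 1, mem_image_of_mem _ hi, ?_⟩)
        have := hpos i hi
        omega
      have h1 := congrFun (congrArg coefs h) (comp n T)
      rw [map_sum, Finset.sum_apply, sum_eq_single w, map_smul, Pi.smul_apply,
        coefs_Theta_comp hT, if_pos hcov, map_zero] at h1
      · simpa using h1
      · intro v hv hne
        rw [map_smul, Pi.smul_apply, coefs_Theta_comp hT]
        split_ifs with hc
        · rw [ih _ _ v hv rfl, zero_smul]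
          rw [← hk]
          refine (peakSet_leftSparse v.1).sum_lt hsp hc fun he => hne ?_
          exact Subtype.ext (peakSet_injective _ _ (v.2.trans w.2.symm) he)
        · rw [smul_zero]
      · exact fun hn => absurd hw hn
  exact fun w hw => key _ w hw rfl

/-! ### Equality of the peak algebra and the Euler algebra -/

theorem Theta_mem_eulerDeg {n : ℕ} {S : Finset ℕ} (hS : S ⊆ Icc 1 n) (hs : LeftSparse S) :
    (Theta n S : MvPowerSeries ℕ ℚ) ∈ eulerDeg (n + 1) :=
  ⟨mem_eulerAlgebra.2 ⟨(Theta n S).2, euler_Theta hS hs⟩, fun _ hβ => coefs_Theta_of_sum_ne hβ⟩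

/-- The peak algebra is the algebra of quasisymmetric functions satisfying the Euler relations. -/
theorem peak_eq_eulerAlgebra : Peak = eulerAlgebra := by
  refine le_antisymm peak_le_eulerAlgebra ?_
  refine eulerAlgebra_le_of_eulerDeg_le (V := Subalgebra.toSubmodule Peak) (one_mem Peak)
    fun n => ?_
  have hsub : ∀ v : Word n, peakSet v.1 ⊆ Icc 1 n := fun v => by
    have := peakSet_subset v.1
    rwa [v.2] at this
  refine (eulerDeg_le_span (linearIndependent_Theta n)
    fun w => Theta_mem_eulerDeg (hsub w) (peakSet_leftSparse _)).trans ?_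
  rw [Submodule.span_le]
  rintro _ ⟨w, rfl⟩
  exact Algebra.subset_adjoin ⟨n, _, hsub w, peakSet_leftSparse _, rfl⟩

/-! ### Multiplication by the power sum of degree one -/

/-- The sum of the values of `c` at the lists obtained by decreasing one positive entry. -/
def lowerSum : List ℕ → (List ℕ → ℚ) → ℚ
  | [], _ => 0
  | b :: β, c => (if 0 < b then c ((b - 1) :: β) else 0) + lowerSum β (headOp b c)

theorem exps_eq_one_iff (x : ℕ →₀ ℕ) : exps x = [1] ↔ ∃ k, x = Finsupp.single k 1 := by
  constructor
  · intro h
    have hc : x.support.card = 1 := by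
      have := congrArg List.length h
      simpa [exps] using this
    obtain ⟨k, hk, hx⟩ := Finsupp.card_support_eq_one.1 hc
    have hs : x.support = {k} := by
      rw [hx]; exact Finsupp.support_single _ hk
    rw [exps, hs, sort_singleton] at h
    simp only [List.map_cons, List.map_nil, List.cons.injEq, and_true] at h
    exact ⟨k, by rw [hx, h]⟩
  · rintro ⟨k, rfl⟩
    rw [exps, Finsupp.support_single _ one_ne_zero, sort_singleton]
    simp

theorem sum_range_lower (β : List ℕ) (g : (ℕ →₀ ℕ) → ℚ) :
    (∑ k ∈ range β.length, if 0 < β.toFinsupp k then g (β.toFinsupp - Finsupp.single k 1) else 0) =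
      lowerSum β (fun X => g X.toFinsupp) := by
  induction β generalizing g with
  | nil => simp [lowerSum]
  | cons b β ih =>
    have e0 : fcons b β.toFinsupp - Finsupp.single 0 1 = fcons (b - 1) β.toFinsupp := by
      ext n
      cases n <;> simp [fcons_zero, fcons_succ]
    have e1 : ∀ k, fcons b β.toFinsupp - Finsupp.single (k + 1) 1 =
        fcons b (β.toFinsupp - Finsupp.single k 1) := by
      intro k
      ext n
      cases n <;> simp [fcons_zero, fcons_succ, Finsupp.single_apply]
    rw [List.length_cons, sum_range_succ', lowerSum, add_comm]
    simp only [toFinsupp_cons, e0, e1, fcons_zero, fcons_succ]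
    have e2 : headOp b (fun X => g X.toFinsupp) = fun X => g (fcons b X.toFinsupp) :=
      funext fun X => by rw [headOp_apply, toFinsupp_cons]
    rw [ih (fun x => g (fcons b x)), e2]

theorem coefs_M_mul (f : MvPowerSeries ℕ ℚ) (β : List ℕ) :
    coefs ((M 0 ∅ : MvPowerSeries ℕ ℚ) * f) β = lowerSum β (coefs f) := by
  have hM : ∀ x, MvPowerSeries.coeff x (M 0 ∅ : MvPowerSeries ℕ ℚ) =
      if exps x = [1] then 1 else 0 := by
    intro x
    have : comp 0 ∅ = [1] := by simp [comp, gaps]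
    rw [← this]
    exact coeff_monoSeries _ _
  have h : lowerSum β (coefs f) = _ :=
    (sum_range_lower β (fun x => MvPowerSeries.coeff x f)).symm
  rw [h, coefs_apply, MvPowerSeries.coeff_mul]
  simp only [hM, ite_mul, one_mul, zero_mul]
  rw [← sum_filter, ← sum_filter]
  symm
  refine sum_bij (fun k _ => (Finsupp.single k 1, β.toFinsupp - Finsupp.single k 1)) ?_ ?_ ?_ ?_
  · intro k hk
    have hk := (mem_filter.1 hk).2
    rw [mem_filter, HasAntidiagonal.mem_antidiagonal]
    refine ⟨?_, (exps_eq_one_iff _).2 ⟨k, rfl⟩⟩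
    refine add_tsub_cancel_of_le ?_
    rw [Finsupp.single_le_iff]
    omega
  · intro k _ k' _ h
    exact Finsupp.single_left_injective one_ne_zero (Prod.ext_iff.1 h).1
  · rintro ⟨x, y⟩ hxy
    rw [mem_filter, HasAntidiagonal.mem_antidiagonal, exps_eq_one_iff] at hxy
    obtain ⟨h1, k, hk⟩ := hxy
    simp only at h1 hk
    subst hk
    have hpos : 0 < β.toFinsupp k := by
      rw [← h1]; simp
    refine ⟨k, mem_filter.2 ⟨mem_range.2 ?_, hpos⟩, ?_⟩
    · by_contra hlt
      rw [List.toFinsupp_apply_le _ _ (by omega)] at hpos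
      omega
    · rw [← h1, add_tsub_cancel_left]
  · intro k _; rfl

theorem lowerSum_replicate (r : ℕ) : ∀ {c : List ℕ → ℚ}, ZeroInsensitive c →
    lowerSum (List.replicate (r + 1) 1) c = (r + 1) * c (List.replicate r 1) := by
  induction r with
  | zero => intro c z; simp [lowerSum, z.cons_zero]
  | succ r ih =>
    intro c z
    rw [List.replicate_succ, lowerSum, if_pos one_pos, Nat.sub_self, z.cons_zero,
      ih (z.tail 1), headOp_apply, List.replicate_succ]
    push_cast
    ring

/-- Lowering any of the r + 1 final ones leaves the same list after removal of zeros; the hypothesis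
kills the terms in which an entry of γ is lowered. -/
theorem lowerSum_append_replicate (r : ℕ) (γ : List ℕ) : ∀ {c : List ℕ → ℚ}, ZeroInsensitive c →
    (∀ γ₁ b γ₂, γ = γ₁ ++ b :: γ₂ → 0 < b →
      c (γ₁ ++ (b - 1) :: γ₂ ++ List.replicate (r + 1) 1) = 0) →
    lowerSum (γ ++ List.replicate (r + 1) 1) c = (r + 1) * c (γ ++ List.replicate r 1) := by
  induction γ with
  | nil => intro c z _; exact lowerSum_replicate r z
  | cons b γ ih =>
    intro c z h
    rw [List.cons_append, lowerSum, ih (z.tail b)]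
    · have h0 : (if 0 < b then c ((b - 1) :: (γ ++ List.replicate (r + 1) 1)) else 0) = 0 := by
        split_ifs with hb
        · exact h [] b γ rfl hb
        · rfl
      rw [h0, zero_add]
      rfl
    · intro γ₁ x γ₂ he hx
      exact h (b :: γ₁) x γ₂ (by rw [he]; rfl) hx

/-- If no monomial of `M_1 f` ends with an exponent `1`, then `f = 0`. -/
theorem eq_zero_of_M_mul {f : MvPowerSeries ℕ ℚ} (hf : f ∈ QSym)
    (h : ∀ α, coefs ((M 0 ∅ : MvPowerSeries ℕ ℚ) * f) (α ++ [1]) = 0) : f = 0 := by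
  have z := zeroInsensitive_coefs hf
  obtain ⟨d, hd⟩ := hf.1
  -- Downward induction on the length: a list of more than d positive exponents has degree above the
  -- bound d.
  have key : ∀ k, ∀ β : List ℕ, (∀ b ∈ β, 0 < b) → d + 1 ≤ β.length + k → coefs f β = 0 := by
    intro k
    induction k with
    | zero =>
      intro β hp hl
      by_contra hne
      have h1 := hd _ hne
      rw [degree_toFinsupp] at h1
      have := List.length_le_sum_of_one_le β hp
      omega
    | succ k ih =>
      -- At fixed total length, induction on the length j of the part before the final block of r
      -- ones.
      have inner : ∀ j r, ∀ γ : List ℕ, γ.length = j → (∀ b ∈ γ, 0 < b) →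
          d + 1 ≤ j + r + (k + 1) → coefs f (γ ++ List.replicate r 1) = 0 := by
        intro j
        induction j using Nat.strong_induction_on with
        | _ j ihj =>
          intro r γ hj hp hl
          have h1 := h (γ ++ List.replicate r 1)
          rw [List.append_assoc, ← List.replicate_succ', coefs_M_mul,
            lowerSum_append_replicate r γ z] at h1
          · have : (r + 1 : ℚ) ≠ 0 := by positivity
            exact (mul_eq_zero.1 h1).resolve_left this
          · rintro γ₁ b γ₂ rfl hb
            simp only [List.length_append, List.length_cons] at hj
            -- Lowering an entry 1 deletes it: the total length is unchanged but γ is shorter.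
            -- Lowering a larger entry gives a longer list, already handled by the outer induction.
            by_cases hb1 : b = 1
            · subst hb1
              have h2 := ihj (γ₁.length + γ₂.length) (by omega) (r + 1) (γ₁ ++ γ₂)
                (by simp) (fun x hx => hp x (by
                  rcases List.mem_append.1 hx with hx | hx <;> simp [hx])) (by omega)
              rw [List.append_assoc] at h2
              rw [Nat.sub_self, List.append_assoc, List.cons_append, z.insert_zero, h2]
            · refine ih _ (fun x hx => ?_) ?_
              · simp only [List.mem_append, List.mem_cons, List.mem_replicate] at hx
                rcases hx with (hx | rfl | hx) | hx
                · exact hp x (by simp [hx])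
                · omega
                · exact hp x (by simp [hx])
                · omega
              · simp only [List.length_append, List.length_cons, List.length_replicate]
                omega
      intro β hp hl
      have := inner β.length 0 β rfl hp (by omega)
      simpa using this
  apply coefs_injective
  rw [map_zero]
  refine z.ext (fun β => rfl) fun β hp => ?_
  exact key (d + 1) β hp (by omega)

/-! ### Independence of the eigenvectors -/

theorem eq_zero_of_lift_lift {f : QSym} (h : lift (lift f) = 0)
    (h0 : coefs f [] = 0) : f = 0 := by
  have z := zeroInsensitive_coefs f.2
  apply Subtype.ext
  apply coefs_injective
  rw [ZeroMemClass.coe_zero, map_zero]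
  refine z.ext (fun β => rfl) fun β hp => ?_
  induction β using List.reverseRecOn with
  | nil => exact h0
  | append_singleton α m _ =>
    obtain ⟨m, rfl⟩ : ∃ k, m = k + 1 := ⟨m - 1, by have := hp m (by simp); omega⟩
    rw [← (doubleShift_lift f).add, h, ZeroMemClass.coe_zero, map_zero]
    rfl

/-- No monomial of L² g has last exponent 1, so the same holds for Θ_1 f. -/
theorem eq_zero_of_thetaOne_mul {f g : QSym} (h : ThetaOne * f + lift (lift g) = 0) :
    f = 0 := by
  apply Subtype.ext
  refine eq_zero_of_M_mul f.2 fun α => ?_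
  have h1 : coefs ((ThetaOne * f + lift (lift g) : QSym) : MvPowerSeries ℕ ℚ) (α ++ [1]) = 0 := by
    rw [h, ZeroMemClass.coe_zero, map_zero]; rfl
  rw [Subalgebra.coe_add, map_add, Pi.add_apply, (doubleShift_lift g).one, add_zero,
    thetaOne_eq, smul_mul_assoc] at h1
  have h2 : (2 : ℚ) * coefs ((M 0 ∅ : MvPowerSeries ℕ ℚ) * f) (α ++ [1]) = 0 := h1
  linarith

theorem coefs_omega_nil (w : CDWord) : coefs (Omega w) [] = 0 := by
  cases w with
  | nil => exact coefs_Theta_of_sum_ne (by simp)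
  | cons l w =>
    cases l with
    | c =>
      have e : Omega (Letter.c :: w) = (2 : ℚ) • (M 0 ∅ * Omega w) := by
        rw [← smul_mul_assoc, ← thetaOne_eq]; rfl
      have h : coefs (Omega (Letter.c :: w)) [] =
          (2 : ℚ) * coefs ((M 0 ∅ : MvPowerSeries ℕ ℚ) * Omega w) [] := by rw [e]; rfl
      rw [h, coefs_M_mul, lowerSum, mul_zero]
    | d => exact coefs_lift_nil _

/-- Sorting by first letter; the empty word contributes Θ_1 = Θ_1 · 1, hence the constant next to
the words starting with c. -/
theorem linearCombination_omega (l : CDWord →₀ ℚ) :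
    Finsupp.linearCombination ℚ Omega l = ThetaOne * (l [] • 1 + Finsupp.linearCombination ℚ Omega
      (l.comapDomain (Letter.c :: ·) (List.cons_injective.injOn))) +
      lift (lift (Finsupp.linearCombination ℚ Omega
        (l.comapDomain (Letter.d :: ·) (List.cons_injective.injOn)))) := by
  induction l using Finsupp.induction_linear with
  | zero => simp
  | add l l' h h' =>
    rw [map_add, h, h', Finsupp.comapDomain_add_of_injective List.cons_injective,
      Finsupp.comapDomain_add_of_injective List.cons_injective]
    simp only [map_add, Finsupp.add_apply, add_smul, mul_add]
    abel
  | single w a =>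
    have single_cons : ∀ (x : Letter) (v : CDWord),
        (Finsupp.single (x :: v) a).comapDomain (x :: ·) (List.cons_injective.injOn) =
        Finsupp.single v a := by
      intro x v
      ext u
      simp
    have single_ne : ∀ (x : Letter) (v : CDWord), (∀ u, v ≠ x :: u) →
        (Finsupp.single v a).comapDomain (x :: ·) (List.cons_injective.injOn) = 0 := by
      intro x v hv
      ext u
      simp [hv u]
    rw [Finsupp.linearCombination_single]
    match w with
    | [] =>
      rw [single_ne _ _ (by simp), single_ne _ _ (by simp)]
      simp [Omega, wordOp]
    | Letter.c :: w =>
      rw [single_cons, single_ne _ _ (by simp), Finsupp.linearCombination_single]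
      simp [Omega, wordOp]
    | Letter.d :: w =>
      rw [single_cons, single_ne _ _ (by simp), Finsupp.linearCombination_single]
      simp [Omega, wordOp]

theorem coefs_linearCombination_omega_nil (l : CDWord →₀ ℚ) :
    coefs (Finsupp.linearCombination ℚ Omega l : QSym) [] = 0 := by
  rw [Finsupp.linearCombination_apply, Finsupp.sum, coefs_sum_coe]
  refine sum_eq_zero fun w _ => ?_
  have : coefs (l w • Omega w : QSym) [] = l w * coefs (Omega w) [] := rfl
  rw [this, coefs_omega_nil, mul_zero]

theorem eq_zero_of_smul_one_add {r : ℚ} {l : CDWord →₀ ℚ}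
    (h : r • (1 : QSym) + Finsupp.linearCombination ℚ Omega l = 0) :
    r = 0 ∧ Finsupp.linearCombination ℚ Omega l = 0 := by
  have h1 : coefs ((r • (1 : QSym) + Finsupp.linearCombination ℚ Omega l : QSym) :
      MvPowerSeries ℕ ℚ) [] = 0 := by
    rw [h, ZeroMemClass.coe_zero, map_zero]; rfl
  rw [Subalgebra.coe_add, map_add, Pi.add_apply, coefs_linearCombination_omega_nil, add_zero] at h1
  have h2 : r * coefs 1 [] = 0 := h1
  rw [coefs_one, if_pos (by simp), mul_one] at h2
  exact ⟨h2, by simpa [h2] using h⟩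

/-- Induction on the length of the words. The part multiplied by Θ_1 vanishes first, then the part
under L², which is injective on functions without constant term; constants separate because no Ω_w
has one. -/
theorem linearIndependent_omega : LinearIndependent ℚ Omega := by
  have key : ∀ N, ∀ l : CDWord →₀ ℚ, (∀ w, l w ≠ 0 → w.length < N) →
      Finsupp.linearCombination ℚ Omega l = 0 → l = 0 := by
    intro N
    induction N with
    | zero =>
      intro l hl _
      ext w
      by_contra hw
      exact absurd (hl w hw) (by omega)
    | succ N ih =>
      intro l hl h
      rw [linearCombination_omega] at h
      have h1 := eq_zero_of_thetaOne_mul h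
      rw [h1, mul_zero, zero_add] at h
      obtain ⟨h2, h3⟩ := eq_zero_of_smul_one_add h1
      have h4 := eq_zero_of_lift_lift h (coefs_linearCombination_omega_nil _)
      have hc := ih _ (fun w hw => by simpa using hl (Letter.c :: w) hw) h3
      have hd := ih _ (fun w hw => by simpa using hl (Letter.d :: w) hw) h4
      ext w
      match w with
      | [] => exact h2
      | Letter.c :: w => exact DFunLike.congr_fun hc w
      | Letter.d :: w => exact DFunLike.congr_fun hd w
  rw [linearIndependent_iff]
  intro l h
  refine key (l.support.sup List.length + 1) l (fun w hw => ?_) h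
  exact Nat.lt_succ_of_le (le_sup (f := List.length) (Finsupp.mem_support_iff.2 hw))

/-- The family consisting of `1` and the `Ω_w`. -/
def omegaFamily : Option CDWord → QSym
  | none => 1
  | some w => Omega w

theorem linearIndependent_omegaFamily : LinearIndependent ℚ omegaFamily := by
  rw [linearIndependent_option]
  refine ⟨linearIndependent_omega, fun h => ?_⟩
  obtain ⟨l, hl⟩ := (Finsupp.mem_span_range_iff_exists_finsupp).1 h
  have h1 : (1 : ℚ) • (1 : QSym) + Finsupp.linearCombination ℚ Omega (-l) = 0 := by
    rw [map_neg, one_smul, Finsupp.linearCombination_apply, add_neg_eq_zero]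
    exact hl.symm
  exact one_ne_zero (eq_zero_of_smul_one_add h1).1

theorem omega_mem_eulerDeg (w : CDWord) :
    (Omega w : MvPowerSeries ℕ ℚ) ∈ eulerDeg (wordDeg w + 1) := by
  refine ⟨omega_mem_eulerAlgebra w, ?_⟩
  have h1 : (ThetaOne : MvPowerSeries ℕ ℚ).IsHomogeneous 1 :=
    isHomogeneous_iff.2 fun β hβ => coefs_Theta_of_sum_ne hβ
  induction w with
  | nil => exact isHomogeneous_iff.1 h1
  | cons l w ih =>
    cases l with
    | c =>
      have e : ((Omega (Letter.c :: w) : QSym) : MvPowerSeries ℕ ℚ) = ThetaOne * Omega w := rfl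
      rw [← isHomogeneous_iff, e, wordDeg, add_comm]
      exact h1.mul (isHomogeneous_iff.2 ih)
    | d =>
      intro β hβ
      have hs := doubleShift_lift (Omega w)
      have z := zeroInsensitive_coefs (lift (lift (Omega w))).2
      change coefs (lift (lift (Omega w))) β = 0
      rw [wordDeg] at hβ
      induction β using List.reverseRecOn with
      | nil => exact coefs_lift_nil _
      | append_singleton α m ihα =>
        rw [List.sum_append, List.sum_singleton] at hβ
        match m with
        | 0 => rw [z.insert_zero, List.append_nil]; exact ihα hβ
        | 1 => exact hs.one α
        | 2 => exact hs.two α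
        | m + 3 =>
          rw [hs.add]
          refine ih _ ?_
          rw [List.sum_append, List.sum_singleton]
          omega

/-! ### Bases of the homogeneous components and of Π -/

theorem eulerDeg_eq_span_omega (n : ℕ) : eulerDeg (n + 1) =
    Submodule.span ℚ ((fun w => (Omega w : MvPowerSeries ℕ ℚ)) '' {w | wordDeg w = n}) := by
  have himg : (fun w => (Omega w : MvPowerSeries ℕ ℚ)) '' {w | wordDeg w = n} =
      Set.range (fun w : Word n => (Omega w.1 : MvPowerSeries ℕ ℚ)) := by
    rw [Set.image_eq_range]; rfl
  have hm : ∀ w : Word n, (Omega w.1 : MvPowerSeries ℕ ℚ) ∈ eulerDeg (n + 1) := by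
    rintro ⟨w, rfl⟩
    exact omega_mem_eulerDeg w
  rw [himg]
  refine le_antisymm (eulerDeg_le_span ?_ hm) (Submodule.span_le.2 ?_)
  · have h := linearIndependent_omega.map' QSym.val.toLinearMap
      (LinearMap.ker_eq_bot.2 Subtype.val_injective)
    exact h.comp (fun w : Word n => w.1) Subtype.val_injective
  · rintro _ ⟨w, rfl⟩
    exact hm w

theorem omega_mem_peak (w : CDWord) : (Omega w : MvPowerSeries ℕ ℚ) ∈ Peak := by
  rw [peak_eq_eulerAlgebra]
  exact omega_mem_eulerAlgebra w

/-- `Ω_w` as an element of the peak algebra. -/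
def peakOmega (w : CDWord) : Peak := ⟨Omega w, omega_mem_peak w⟩

theorem span_peakOmega (n : ℕ) :
    Submodule.span ℚ (peakOmega '' {w | wordDeg w = n}) = PeakDeg (n + 1) := by
  have hinj : Function.Injective Peak.val.toLinearMap := Subtype.val_injective
  apply Submodule.map_injective_of_injective hinj
  rw [Submodule.map_span, ← Set.image_comp]
  refine (eulerDeg_eq_span_omega n).symm.trans ?_
  ext f
  rw [mem_eulerDeg, ← peak_eq_eulerAlgebra, ← isHomogeneous_iff]
  constructor
  · rintro ⟨h1, h2⟩
    exact ⟨⟨f, h1⟩, h2, rfl⟩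
  · rintro ⟨g, h1, rfl⟩
    exact ⟨g.2, h1⟩

/-- The family consisting of `1` and the `Ω_w`, in the peak algebra. -/
def peakFamily : Option CDWord → Peak
  | none => 1
  | some w => peakOmega w

theorem linearIndependent_peakFamily : LinearIndependent ℚ peakFamily := by
  apply LinearIndependent.of_comp Peak.val.toLinearMap
  have h := linearIndependent_omegaFamily.map' QSym.val.toLinearMap
    (LinearMap.ker_eq_bot.2 Subtype.val_injective)
  have e : (Peak.val.toLinearMap ∘ peakFamily : Option CDWord → MvPowerSeries ℕ ℚ) =
      QSym.val.toLinearMap ∘ omegaFamily := by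
    funext w
    cases w <;> rfl
  rw [e]
  exact h

theorem span_peakFamily : ⊤ ≤ Submodule.span ℚ (Set.range peakFamily) := by
  have hV : Subalgebra.toSubmodule eulerAlgebra ≤
      (Submodule.span ℚ (Set.range peakFamily)).map Peak.val.toLinearMap := by
    refine eulerAlgebra_le_of_eulerDeg_le ?_ fun n => ?_
    · exact ⟨1, Submodule.subset_span ⟨none, rfl⟩, rfl⟩
    · rw [eulerDeg_eq_span_omega, Submodule.span_le]
      rintro _ ⟨w, _, rfl⟩
      exact ⟨peakOmega w, Submodule.subset_span ⟨some w, rfl⟩, rfl⟩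
  intro f _
  have hf : (f : MvPowerSeries ℕ ℚ) ∈ eulerAlgebra := peak_eq_eulerAlgebra ▸ f.2
  obtain ⟨g, hg, he⟩ := hV hf
  rwa [show f = g from Subtype.ext he.symm]

/-- The basis of the peak algebra consisting of `1` and the `Ω_w`. -/
def peakBasis : Module.Basis (Option CDWord) ℚ Peak :=
  Module.Basis.mk linearIndependent_peakFamily span_peakFamily

theorem peakBasis_none : peakBasis none = 1 := by
  rw [peakBasis, Module.Basis.mk_apply]; rfl

theorem peakBasis_some (w : CDWord) : peakBasis (some w) = peakOmega w := by
  rw [peakBasis, Module.Basis.mk_apply]; rfl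

/-! ### The spectrum -/

/-- The eigenvalues at the members of `peakBasis`. -/
def eigenval : Option CDWord → ℚ
  | none => 1
  | some w => 2 ^ (cCount w + 1)

theorem stembridgePeak_peakOmega (w : CDWord) :
    stembridgePeak (peakOmega w) = (2 : ℚ) ^ (cCount w + 1) • peakOmega w :=
  Subtype.ext (stembridge_omega w)

theorem stembridgePeak_peakBasis (i : Option CDWord) :
    stembridgePeak (peakBasis i) = eigenval i • peakBasis i := by
  cases i with
  | none =>
    rw [peakBasis_none, eigenval, one_smul]
    exact stembridge_one
  | some w => rw [peakBasis_some, stembridgePeak_peakOmega, eigenval]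

theorem repr_stembridgePeak (f : Peak) (i : Option CDWord) :
    peakBasis.repr (stembridgePeak f) i = eigenval i * peakBasis.repr f i := by
  have key : peakBasis.coord i ∘ₗ stembridgePeak = eigenval i • peakBasis.coord i := by
    apply peakBasis.ext
    intro j
    rw [LinearMap.comp_apply, stembridgePeak_peakBasis, map_smul, LinearMap.smul_apply,
      Module.Basis.coord_apply, Module.Basis.repr_self]
    by_cases h : j = i
    · rw [h]
    · rw [Finsupp.single_eq_of_ne' h, smul_zero, smul_zero]
  exact LinearMap.congr_fun key f

theorem hasEigenvector_peakOmega (w : CDWord) :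
    Module.End.HasEigenvector stembridgePeak ((2 : ℚ) ^ (cCount w + 1)) (peakOmega w) := by
  rw [Module.End.hasEigenvector_iff, Module.End.mem_eigenspace_iff]
  exact ⟨stembridgePeak_peakOmega w, peakBasis_some w ▸ peakBasis.ne_zero _⟩

theorem iSup_eigenspace_stembridgePeak :
    (⨆ μ : ℚ, Module.End.eigenspace stembridgePeak μ) = ⊤ := by
  rw [eq_top_iff, ← peakBasis.span_eq, Submodule.span_le]
  rintro _ ⟨i, rfl⟩
  exact Submodule.mem_iSup_of_mem (eigenval i)
    (Module.End.mem_eigenspace_iff.2 (stembridgePeak_peakBasis i))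

theorem stembridgePeak_mem_peakDeg (n : ℕ) (f : Peak) (hf : f ∈ PeakDeg (n + 1)) :
    stembridgePeak f ∈ PeakDeg (n + 1) := by
  rw [← span_peakOmega] at hf ⊢
  have h : Submodule.span ℚ (peakOmega '' {w | wordDeg w = n}) ≤
      (Submodule.span ℚ (peakOmega '' {w | wordDeg w = n})).comap stembridgePeak := by
    rw [Submodule.span_le]
    rintro _ ⟨w, hw, rfl⟩
    rw [SetLike.mem_coe, Submodule.mem_comap, stembridgePeak_peakOmega]
    exact Submodule.smul_mem _ _ (Submodule.subset_span ⟨w, hw, rfl⟩)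
  exact h hf

theorem wordDeg_eq_cCount_add (w : CDWord) : ∃ k, wordDeg w = cCount w + 2 * k := by
  induction w with
  | nil => exact ⟨0, rfl⟩
  | cons l w ih =>
    obtain ⟨k, hk⟩ := ih
    cases l with
    | c => exact ⟨k, by rw [wordDeg, cCount, hk]; ring⟩
    | d => exact ⟨k + 1, by rw [wordDeg, cCount, hk]; ring⟩

theorem exists_word (m k : ℕ) : ∃ w, cCount w = m ∧ wordDeg w = m + 2 * k := by
  induction k with
  | zero =>
    induction m with
    | zero => exact ⟨[], rfl, rfl⟩
    | succ m ih =>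
      obtain ⟨w, h1, h2⟩ := ih
      exact ⟨Letter.c :: w, by rw [cCount, h1], by rw [wordDeg, h2]⟩
  | succ k ih =>
    obtain ⟨w, h1, h2⟩ := ih
    exact ⟨Letter.d :: w, h1, by rw [wordDeg, h2]; rfl⟩

theorem exists_hasEigenvector_iff (n : ℕ) (μ : ℚ) :
    (∃ f ∈ PeakDeg (n + 1), Module.End.HasEigenvector stembridgePeak μ f) ↔
      ∃ k : ℕ, k ≤ n / 2 ∧ μ = (2 : ℚ) ^ (n + 1 - 2 * k) := by
  constructor
  · rintro ⟨f, hf, hev⟩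
    have himg : peakOmega '' {w | wordDeg w = n} =
        peakBasis '' (some '' {w | wordDeg w = n}) := by
      rw [← Set.image_comp]
      exact Set.image_congr fun w _ => (peakBasis_some w).symm
    rw [← span_peakOmega, himg, Module.Basis.mem_span_image] at hf
    obtain ⟨hev, hne⟩ := Module.End.hasEigenvector_iff.1 hev
    rw [Module.End.mem_eigenspace_iff] at hev
    have hne' : peakBasis.repr f ≠ 0 := fun h => hne (peakBasis.repr.map_eq_zero_iff.1 h)
    -- Some coordinate is nonzero, and homogeneity makes it that of a word of degree n; comparing
    -- this coordinate in the eigenvalue equation identifies μ.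
    obtain ⟨i, hi⟩ := Finsupp.ne_iff.1 hne'
    obtain ⟨w, hw, rfl⟩ := hf (Finsupp.mem_support_iff.2 hi)
    have h1 := repr_stembridgePeak f (some w)
    rw [hev, map_smul, Finsupp.smul_apply, smul_eq_mul] at h1
    have h2 := mul_right_cancel₀ hi h1
    obtain ⟨k, hk⟩ := wordDeg_eq_cCount_add w
    have hw : wordDeg w = n := hw
    refine ⟨k, by omega, ?_⟩
    rw [h2, eigenval, show n + 1 - 2 * k = cCount w + 1 by omega]
  · rintro ⟨k, hk, rfl⟩
    -- A word with k letters d and n - 2k letters c; the truncated subtraction is exact since k ≤ n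
    -- / 2.
    obtain ⟨w, h1, h2⟩ := exists_word (n - 2 * k) k
    refine ⟨peakOmega w, ?_, ?_⟩
    · rw [← span_peakOmega]
      exact Submodule.subset_span ⟨w, show wordDeg w = n by omega, rfl⟩
    · rw [show n + 1 - 2 * k = cCount w + 1 by omega]
      exact hasEigenvector_peakOmega w

theorem wordOp_mem_peak (w : CDWord) (f : QSym) (hf : (f : MvPowerSeries ℕ ℚ) ∈ Peak) :
    (wordOp w f : MvPowerSeries ℕ ℚ) ∈ Peak := by
  rw [peak_eq_eulerAlgebra] at hf ⊢
  exact wordOp_mem_eulerAlgebra w hf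

theorem linearIndependent_peakOmega : LinearIndependent ℚ peakOmega := by
  have h := peakBasis.linearIndependent.comp some (Option.some_injective _)
  rwa [show (peakBasis ∘ some : CDWord → Peak) = peakOmega from funext peakBasis_some] at h

end PeakAlgebra

end

theorem mainTheorem2 :
    -- the operators `ŵ` map `Π` to `Π`
    (∀ (w : PeakAlgebra.CDWord) (f : PeakAlgebra.QSym), (f : MvPowerSeries ℕ ℚ) ∈ PeakAlgebra.Peak →
      (PeakAlgebra.wordOp w f : MvPowerSeries ℕ ℚ) ∈ PeakAlgebra.Peak) ∧
    -- `ϑ` is diagonalizable on `Π`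
    (⨆ μ : ℚ, Module.End.eigenspace PeakAlgebra.stembridgePeak μ) = ⊤ ∧
    -- the elements `Ω_w`, regarded as elements of `Π`
    (∃ Ω : PeakAlgebra.CDWord → PeakAlgebra.Peak,
      (∀ w, (Ω w : MvPowerSeries ℕ ℚ) = PeakAlgebra.Omega w) ∧
      -- each is an eigenvector, with eigenvalue `2 ^ (|w|_c + 1)`
      (∀ w, Module.End.HasEigenvector PeakAlgebra.stembridgePeak
        ((2 : ℚ) ^ (PeakAlgebra.cCount w + 1)) (Ω w)) ∧
      -- those with `deg w = n` form a basis of `Π_{n+1}`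
      (∀ n : ℕ,
        LinearIndependent ℚ
          (fun w : {w : PeakAlgebra.CDWord // PeakAlgebra.wordDeg w = n} => Ω w.1) ∧
        Submodule.span ℚ (Ω '' {w | PeakAlgebra.wordDeg w = n}) =
          PeakAlgebra.PeakDeg (n + 1)) ∧
      -- all of them, together with `1` in degree `0`, form a basis of `Π`
      (∃ b : Module.Basis (Option PeakAlgebra.CDWord) ℚ PeakAlgebra.Peak,
        b none = 1 ∧ ∀ w, b (some w) = Ω w)) ∧
    -- `ϑ` preserves `Π_{n+1}`, and there its eigenvalues are the `2 ^ (n + 1 - 2 k)`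
    (∀ n : ℕ,
      (∀ f ∈ PeakAlgebra.PeakDeg (n + 1),
        PeakAlgebra.stembridgePeak f ∈ PeakAlgebra.PeakDeg (n + 1)) ∧
      ∀ μ : ℚ,
        (∃ f ∈ PeakAlgebra.PeakDeg (n + 1),
          Module.End.HasEigenvector PeakAlgebra.stembridgePeak μ f) ↔
        ∃ k : ℕ, k ≤ n / 2 ∧ μ = (2 : ℚ) ^ (n + 1 - 2 * k)) := by
  refine ⟨PeakAlgebra.wordOp_mem_peak, PeakAlgebra.iSup_eigenspace_stembridgePeak,
    ⟨PeakAlgebra.peakOmega, fun w => rfl, PeakAlgebra.hasEigenvector_peakOmega, fun n => ⟨?_, ?_⟩,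
      PeakAlgebra.peakBasis, PeakAlgebra.peakBasis_none, PeakAlgebra.peakBasis_some⟩,
    fun n => ⟨PeakAlgebra.stembridgePeak_mem_peakDeg n,
      PeakAlgebra.exists_hasEigenvector_iff n⟩⟩
  · exact PeakAlgebra.linearIndependent_peakOmega.comp _ Subtype.val_injective
  · exact PeakAlgebra.span_peakOmega n
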